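/- Let $(p_k)_{k\ge 0}$ be a probability distribution on $\{0,1,2,\dots\}$ with $p_0=0$ and $0<p_1<1$, and let $Z=(Z_n)_{n\ge 0}$, $Z_0=1$, be the Galton–Watson process with offspring distribution $(p_k)$. Assume $E[Z_1\log Z_1]<\infty$, put $m=E[Z_1]=\sum_k kp_k$ (so $1<m<\infty$), and let $\gamma>0$ be the Schröder constant, defined by $m^{-\gamma}=p_1$. Let $X_1,X_2,\dots$ be i.i.d. real random variables, independent of $Z$, with distribution function $F$, and let $S_k=X_1+\cdots+X_k$. Let $0<\alpha<2$ and $\beta>0$, and assume the following. (A) $P(X_1\ge x)\sim x^{-\beta}L(x)$ as $x\to\infty$ for a function $L$ slowly varying at infinity; if $1<\alpha<2$, then $X_1$ is integrable and $E[X_1]=0$; and $X_1$ is in the domain of attraction of a nondegenerate strictly $\alpha$-stable law: $S_k/b(k)$ converges in distribution to a nondegenerate strictly $\alpha$-stable random variable $U_s$, where $b$ is continuous and increasing from $[0,\infty)$ onto $[0,\infty)$ with $b(0)=0$ and $b(x)>0$ for $x>0$. Write $b(x)=x^{1/\alpha}s(x)$ for $x>0$. (B) Let $p_+=\lim_{x\to\infty}\frac{1-F(x)}{1-F(x)+F(-x)}$.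 Then: * if $1<\alpha<2$, then $\liminf_{x\to\infty}s(x)\in(0,\infty]$; * if $0<p_+<1$ and $\alpha=1$, then $\int_{[-x,x]}y\,F(dy)=0$ for all $x>0$; * if $p_+=0$, then $\alpha<\beta$; * if $1<\alpha<2$ and $p_+>0$, then $\limsup_{n\to\infty}\frac{F(-b(n)/[\log n]^{1/\alpha})}{(\log n)F(-b(n))}\le 1$, in the sense that for every $\delta>0$ one has $F(-b(n)/[\log n]^{1/\alpha})\le(1+\delta)(\log n)F(-b(n))$ for all large $n$. Suppose that either ($1<\alpha<2$ and $\gamma<\beta-1$), or $E[X_1^{1+\gamma};X_1>0]<\infty$. Then for every $k\ge1$ the limit $q_k=\lim_{n\to\infty}m^{\gamma n}P(Z_n=k)$ exists and is finite, and for every $\varepsilon>0$ the series below converges and $$\lim_{n\to\infty}m^{\gamma n}\,P\left(\frac{S_{Z_n}}{Z_n}\ge\varepsilon\right)=\sum_{k\ge1}q_k\,P(S_k\ge\varepsilon k).$$ -/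

import Mathlib

open MeasureTheory ProbabilityTheory Filter Set Topology

noncomputable section

/-- The Galton-Watson process `Z` started from `Z 0 = 1`, built from the offspring variables
`ξ n i` (number of children of individual `i` of generation `n`). -/
def galtonWatson {Ω : Type*} (ξ : ℕ → ℕ → Ω → ℕ) : ℕ → Ω → ℕ
  | 0, _ => 1
  | n + 1, ω => ∑ i ∈ Finset.range (galtonWatson ξ n ω), ξ n i ω

/-- `S_k = X_1 + ⋯ + X_k`; the variables `X_1, X_2, …` are indexed from `0`. -/
def partialSum {Ω : Type*} (X : ℕ → Ω → ℝ) (k : ℕ) (ω : Ω) : ℝ :=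
  ∑ i ∈ Finset.range k, X i ω

/-- The mean `m = ∑ k p_k` of the offspring distribution. -/
def offspringMean (p : PMF ℕ) : ℝ := ∑' k : ℕ, (k : ℝ) * (p k).toReal

/-- Assumptions on the offspring law: `p_0 = 0`, `0 < p_1 < 1` and `E[Z_1 log Z_1] < ∞`. -/
structure OffspringAssumption (p : PMF ℕ) : Prop where
  zero : p 0 = 0
  one_pos : 0 < p 1
  one_lt : p 1 < 1
  logMoment : Summable fun k : ℕ => (p k).toReal * ((k : ℝ) * Real.log k)

/-- Slow variation at infinity (in the sense of Karamata). -/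
structure IsSlowlyVarying (L : ℝ → ℝ) : Prop where
  measurable : Measurable L
  eventually_pos : ∀ᶠ x in atTop, 0 < L x
  tendsto_ratio : ∀ c : ℝ, 0 < c → Tendsto (fun x => L (c * x) / L x) atTop (𝓝 1)

/-- The probability measure `ρ` is a (nondegenerate) strictly `α`-stable law: if `U, U'` are independent with law `ρ` and
`a, b > 0`, then `a U + b U'` has the law of `(a ^ α + b ^ α) ^ (1 / α) U`. -/
structure IsStrictlyStable (α : ℝ) (ρ : Measure ℝ) : Prop where
  nondegenerate : ∀ x : ℝ, ρ ≠ Measure.dirac x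
  scaling : ∀ a b : ℝ, 0 < a → 0 < b →
    (ρ.map fun x => a * x) ∗ (ρ.map fun x => b * x)
      = ρ.map fun x => (a ^ α + b ^ α) ^ (1 / α) * x

/-- The regularity normalisation of the norming function: `b` is continuous and increasing from
`[0, ∞)` onto `[0, ∞)`, vanishing only at `0`. -/
structure IsNormingFunction (b : ℝ → ℝ) : Prop where
  zero : b 0 = 0
  pos : ∀ x : ℝ, 0 < x → 0 < b x
  continuousOn : ContinuousOn b (Ici 0)
  monotoneOn : MonotoneOn b (Ici 0)
  surjOn : SurjOn b (Ici 0) (Ici 0)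

/-- The tail and centring part of the assumptions on the law `ν` of `X_1`:
`P(X_1 ≥ x) ∼ x ^ (-β) L x` with `L` slowly varying, and `E[X_1] = 0` when `1 < α`. -/
structure StepTailAssumption (ν : Measure ℝ) (α β : ℝ) (L : ℝ → ℝ) : Prop where
  slowlyVarying : IsSlowlyVarying L
  tail : Asymptotics.IsEquivalent atTop (fun x : ℝ => ν.real (Ici x)) (fun x => x ^ (-β) * L x)
  mean_zero : 1 < α → Integrable (fun x : ℝ => x) ν ∧ ∫ x, x ∂ν = 0

/-- `pp` is the limit `p_+` of `(1 - F x) / (1 - F x + F (-x))` as `x → ∞`, where `F` is the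
distribution function of `ν`. -/
def IsTailBalance (ν : Measure ℝ) (pp : ℝ) : Prop :=
  Tendsto (fun x : ℝ => ν.real (Ioi x) / (ν.real (Ioi x) + ν.real (Iic (-x)))) atTop (𝓝 pp)

/-- The further technical assumptions on the law `ν` of `X_1` and the norming function
`b x = x ^ (1 / α) * s x`. -/
structure StepTechnicalAssumption (ν : Measure ℝ) (α β : ℝ) (b : ℝ → ℝ) : Prop where
  /-- If `1 < α` then `liminf s > 0` at infinity. -/
  liminf_pos : 1 < α → ∃ c : ℝ, 0 < c ∧ ∀ᶠ x : ℝ in atTop, c ≤ b x / x ^ (1 / α)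
  /-- If `α = 1` and `0 < p_+ < 1` then the truncated means `∫_{[-x, x]} y F(dy)` vanish. -/
  truncatedMean : ∀ pp : ℝ, IsTailBalance ν pp → 0 < pp → pp < 1 → α = 1 →
    ∀ x : ℝ, 0 < x → ∫ y in Icc (-x) x, y ∂ν = 0
  /-- If `p_+ = 0` then `α < β`. -/
  lt_of_zero : IsTailBalance ν 0 → α < β
  /-- If `1 < α` and `0 < p_+` then
  `limsup F(-b n / (log n) ^ (1 / α)) / ((log n) F(-b n)) ≤ 1`; written without division, so that
  it also makes sense when `F(-b n) = 0` (it then asks that the numerator vanish too). -/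
  leftTail : ∀ pp : ℝ, IsTailBalance ν pp → 1 < α → 0 < pp →
    ∀ δ : ℝ, 0 < δ → ∀ᶠ n : ℕ in atTop,
      ν.real (Iic (-(b n / Real.log n ^ (1 / α))))
        ≤ (1 + δ) * (Real.log n * ν.real (Iic (-b n)))

end

/-! Independence of `Z` and `X` turns the left side into the sum over `k` of `m^(γn) P(Z_n = k)
P(S_k ≥ εk)`, so the theorem is an interchange of limit and sum. Since `m^γ = 1/p_1` and `p_1 P(Z_n
= k) ≤ P(Z_{n+1} = k)`, the weights increase in `n` to `q_k`. They are dominated by their own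
limits, and everything reduces to the convergence of `∑ q_k P(S_k ≥ εk)`.

Size of `q`: let `f` be the offspring generating function. Near the repelling fixed point 1, the gap
of an iterate from 1 is multiplied by nearly `m` at each step, and the `k log k` moment makes the
accumulated error finite. Started at `1 - t`, the iterates leave a fixed neighbourhood of 1 after
about `log(1/t) / log m` steps and then decay like `p_1^n`. Hence `f^[n](1 - t) = O(t^(-γ) p_1^n)`
(`genFun_iterate_one_sub_le`), and `t = 1/(2N)` gives `∑_{k ≤ N} q_k = O(N^γ)`
(`exists_schroeder_limit`).

Size of the deviation: an integrable step has mean zero because the weak limit is nondegenerate, so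
cutting the steps off at some `-M` leaves mean at most `ε/2`. A truncated exponential Chebyshev
bound gives `P(S_k ≥ εk) ≤ k P(X > ck) + k^(-γ-2)` (`exists_partialSum_tail_le`). By Fubini, `∑ q_k
k P(X > ck)` is at most a constant times `E[X^(1+γ); X > 0]` (`summable_mul_tail`), which is finite
in both cases of the hypothesis. -/

/-- The generating function `∑ w k s ^ k` of a sequence of weights. -/
noncomputable def genFun (w : ℕ → ℝ) (s : ℝ) : ℝ := ∑' k, w k * s ^ k

/-- The defect of linearity `∑ w k * k * (k t / (1 + k t))` of a generating function at `1 - t`. -/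
noncomputable def genFunDefect (w : ℕ → ℝ) (t : ℝ) : ℝ := ∑' k : ℕ, w k * k * (k * t / (1 + k * t))

/-! ### Generating functions: decay of iterates below 1 and the defect of linearity at 1. -/

section GenFun

variable {w : ℕ → ℝ}

theorem genFun_summable (hw : ∀ k, 0 ≤ w k) (hs : HasSum w 1) {s : ℝ} (h0 : 0 ≤ s) (h1 : s ≤ 1) :
    Summable fun k => w k * s ^ k :=
  Summable.of_nonneg_of_le (fun k => mul_nonneg (hw k) (pow_nonneg h0 k))
    (fun k => mul_le_of_le_one_right (hw k) (pow_le_one₀ h0 h1)) hs.summable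

theorem genFun_nonneg (hw : ∀ k, 0 ≤ w k) {s : ℝ} (h0 : 0 ≤ s) : 0 ≤ genFun w s :=
  tsum_nonneg fun k => mul_nonneg (hw k) (pow_nonneg h0 k)

theorem genFun_mono (hw : ∀ k, 0 ≤ w k) (hs : HasSum w 1) {s s' : ℝ} (h0 : 0 ≤ s) (h : s ≤ s')
    (h1 : s' ≤ 1) : genFun w s ≤ genFun w s' :=
  (genFun_summable hw hs h0 (h.trans h1)).tsum_le_tsum
    (fun k => mul_le_mul_of_nonneg_left (pow_le_pow_left₀ h0 h k) (hw k))
    (genFun_summable hw hs (h0.trans h) h1)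

theorem genFun_one (hs : HasSum w 1) : genFun w 1 = 1 := by
  simp [genFun, hs.tsum_eq]

theorem genFun_le_one (hw : ∀ k, 0 ≤ w k) (hs : HasSum w 1) {s : ℝ} (h0 : 0 ≤ s) (h1 : s ≤ 1) :
    genFun w s ≤ 1 :=
  (genFun_mono hw hs h0 h1 le_rfl).trans (genFun_one hs).le

/-- The mass away from `w 1` sits at `k ≥ 2`, where `s ^ k ≤ s ^ 2`. The quadratic error is what
makes the corrections summable along the iterates. -/
theorem genFun_le (hw : ∀ k, 0 ≤ w k) (hs : HasSum w 1) (hz : w 0 = 0) {s : ℝ} (h0 : 0 ≤ s)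
    (h1 : s ≤ 1) : genFun w s ≤ w 1 * s + (1 - w 1) * s ^ 2 := by
  have h2 : HasSum (fun k => w k * s ^ 2 + if k = 1 then w 1 * (s - s ^ 2) else 0)
      (1 * s ^ 2 + w 1 * (s - s ^ 2)) :=
    (hs.mul_right _).add (hasSum_ite_eq 1 (w 1 * (s - s ^ 2)))
  refine ((genFun_summable hw hs h0 h1).tsum_le_tsum (fun k => ?_) h2.summable).trans ?_
  · rcases k with _ | _ | k
    · simp [hz]
    · simp only [zero_add, pow_one, if_true]; linarith
    · simp only [Nat.reduceEqDiff, if_false, add_zero]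
      exact mul_le_mul_of_nonneg_left (pow_le_pow_of_le_one h0 h1 (by omega)) (hw _)
  · rw [h2.tsum_eq]; linarith

theorem genFun_iterate_mem (hw : ∀ k, 0 ≤ w k) (hs : HasSum w 1) {s : ℝ} (h : s ∈ Icc (0 : ℝ) 1)
    (n : ℕ) : (genFun w)^[n] s ∈ Icc (0 : ℝ) 1 := by
  induction n with
  | zero => exact h
  | succ n ih =>
    rw [Function.iterate_succ_apply']
    exact ⟨genFun_nonneg hw ih.1, genFun_le_one hw hs ih.1 ih.2⟩

theorem genFun_iterate_mono (hw : ∀ k, 0 ≤ w k) (hs : HasSum w 1) {s s' : ℝ} (h0 : 0 ≤ s)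
    (h : s ≤ s') (h1 : s' ≤ 1) (n : ℕ) : (genFun w)^[n] s ≤ (genFun w)^[n] s' := by
  induction n with
  | zero => exact h
  | succ n ih =>
    rw [Function.iterate_succ_apply', Function.iterate_succ_apply']
    exact genFun_mono hw hs (genFun_iterate_mem hw hs ⟨h0, h.trans h1⟩ n).1 ih
      (genFun_iterate_mem hw hs ⟨h0.trans h, h1⟩ n).2

/-- Below `1` the iterates of a generating function decay at the rate `w 1 ^ n`. -/
theorem genFun_iterate_le (hw : ∀ k, 0 ≤ w k) (hs : HasSum w 1) (hz : w 0 = 0) (hpos : 0 < w 1)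
    (hlt : w 1 < 1) {s : ℝ} (h0 : 0 ≤ s) (h1 : s < 1) :
    ∃ C : ℝ, 0 < C ∧ ∀ n, (genFun w)^[n] s ≤ C * w 1 ^ n := by
  -- A crude contraction factor: `f y ≤ r y` for `y ≤ s`. It gives geometric decay, though not yet
  -- at the rate `w 1`.
  set r : ℝ := w 1 + (1 - w 1) * s with hr
  have hr0 : 0 < r := by have : 0 ≤ (1 - w 1) * s := mul_nonneg (by linarith) h0; linarith
  have hr1 : r < 1 := by nlinarith
  have hmem := genFun_iterate_mem hw hs ⟨h0, h1.le⟩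
  have hgeo : ∀ n, (genFun w)^[n] s ≤ s * r ^ n := by
    intro n
    induction n with
    | zero => simp
    | succ n ih =>
      rw [Function.iterate_succ_apply']
      set y := (genFun w)^[n] s with hy
      have hys : y ≤ s := ih.trans (mul_le_of_le_one_right h0 (pow_le_one₀ hr0.le hr1.le))
      have h2 := genFun_le hw hs hz (hmem n).1 (hmem n).2
      have h3 : w 1 * y + (1 - w 1) * y ^ 2 ≤ y * r := by
        have : (1 - w 1) * (y * y) ≤ (1 - w 1) * (y * s) :=
          mul_le_mul_of_nonneg_left (mul_le_mul_of_nonneg_left hys (hmem n).1) (by linarith)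
        rw [hr]; nlinarith
      calc genFun w y ≤ y * r := h2.trans h3
        _ ≤ s * r ^ n * r := mul_le_mul_of_nonneg_right ih hr0.le
        _ = s * r ^ (n + 1) := by ring
  -- Bootstrap to the sharp rate: each step costs `w 1 * (1 + y / w 1)` with `y ≤ r ^ n`, and the
  -- product of the factors `1 + r ^ n / w 1` stays bounded.
  have hmain : ∀ n, (genFun w)^[n] s ≤
      w 1 ^ n * Real.exp (∑ i ∈ Finset.range n, r ^ i / w 1) := by
    intro n
    induction n with
    | zero => simpa using h1.le
    | succ n ih =>
      rw [Function.iterate_succ_apply', Finset.sum_range_succ, Real.exp_add]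
      set y := (genFun w)^[n] s with hy
      have hyr : y ≤ r ^ n := (hgeo n).trans
        (mul_le_of_le_one_left (pow_nonneg hr0.le n) h1.le)
      have h2 := genFun_le hw hs hz (hmem n).1 (hmem n).2
      have h3 : w 1 * y + (1 - w 1) * y ^ 2 ≤ y * (w 1 * (r ^ n / w 1 + 1)) := by
        have e : w 1 * (r ^ n / w 1 + 1) = r ^ n + w 1 := by field_simp
        rw [e]
        have h4 : (1 - w 1) * y ^ 2 ≤ 1 * y ^ 2 :=
          mul_le_mul_of_nonneg_right (by linarith) (sq_nonneg y)
        nlinarith [mul_le_mul_of_nonneg_left hyr (hmem n).1]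
      calc genFun w y ≤ y * (w 1 * (r ^ n / w 1 + 1)) := h2.trans h3
        _ ≤ (w 1 ^ n * Real.exp (∑ i ∈ Finset.range n, r ^ i / w 1)) *
            (w 1 * Real.exp (r ^ n / w 1)) := by
          gcongr
          exact Real.add_one_le_exp _
        _ = _ := by ring
  refine ⟨Real.exp ((1 - r)⁻¹ / w 1), Real.exp_pos _, fun n => (hmain n).trans ?_⟩
  rw [mul_comm, ← Finset.sum_div]
  gcongr
  exact (summable_geometric_of_lt_one hr0.le hr1).sum_le_tsum _ (fun i _ => pow_nonneg hr0.le i)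
    |>.trans (tsum_geometric_of_lt_one hr0.le hr1).le

/-- By Bernoulli, `(1 - t)^k (1 + kt) ≤ (1 - t²)^k ≤ 1`. The resulting error ratio `kt / (1 + kt)`
is increasing in `t` and sums to order `log k` along a geometric sequence of `t`. -/
theorem one_sub_pow_ge {t : ℝ} (h0 : 0 ≤ t) (h1 : t ≤ 1) (k : ℕ) :
    k * t - k * t * (k * t / (1 + k * t)) ≤ 1 - (1 - t) ^ k := by
  have hk : (0 : ℝ) ≤ k * t := by positivity
  have e : k * t - k * t * (k * t / (1 + k * t)) = 1 - 1 / (1 + k * t) := by field_simp; ring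
  rw [e]
  have h2 : (1 - t) ^ k * (1 + k * t) ≤ 1 := by
    calc (1 - t) ^ k * (1 + k * t) ≤ (1 - t) ^ k * (1 + t) ^ k :=
          mul_le_mul_of_nonneg_left (one_add_mul_le_pow (by linarith) k)
            (pow_nonneg (by linarith) k)
      _ = (1 - t ^ 2) ^ k := by rw [← mul_pow]; ring
      _ ≤ 1 := pow_le_one₀ (by nlinarith) (by nlinarith)
  have : (1 - t) ^ k ≤ 1 / (1 + k * t) := by rw [le_div_iff₀ (by linarith)]; exact h2
  linarith

theorem defect_summable (hw : ∀ k, 0 ≤ w k) (hm : Summable fun k : ℕ => w k * k) {t : ℝ}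
    (h0 : 0 ≤ t) : Summable fun k : ℕ => w k * k * (k * t / (1 + k * t)) := by
  refine Summable.of_nonneg_of_le (fun k => ?_) (fun k => ?_) hm
  · have := hw k; positivity
  · refine mul_le_of_le_one_right (mul_nonneg (hw k) k.cast_nonneg) ?_
    have : (0 : ℝ) ≤ k * t := by positivity
    rw [div_le_one (by linarith)]; linarith

theorem defect_nonneg (hw : ∀ k, 0 ≤ w k) {t : ℝ} (h0 : 0 ≤ t) : 0 ≤ genFunDefect w t :=
  tsum_nonneg fun k => by have := hw k; positivity

theorem defect_mono (hw : ∀ k, 0 ≤ w k) (hm : Summable fun k : ℕ => w k * k) {t t' : ℝ}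
    (h0 : 0 ≤ t) (h : t ≤ t') : genFunDefect w t ≤ genFunDefect w t' := by
  refine (defect_summable hw hm h0).tsum_le_tsum (fun k => ?_) (defect_summable hw hm (h0.trans h))
  refine mul_le_mul_of_nonneg_left ?_ (mul_nonneg (hw k) k.cast_nonneg)
  have h1 : (0 : ℝ) ≤ k * t := by positivity
  have h2 : (k : ℝ) * t ≤ k * t' := by gcongr
  rw [div_le_div_iff₀ (by linarith) (by linarith)]
  nlinarith

/-- The point 1 repels: one application of `f` multiplies the gap `t` by at least `m` minus the
defect. -/
theorem gap_genFun_ge (hw : ∀ k, 0 ≤ w k) (hs : HasSum w 1) {m : ℝ}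
    (hm : HasSum (fun k : ℕ => w k * k) m) {t : ℝ} (h0 : 0 ≤ t) (h1 : t ≤ 1) :
    t * (m - genFunDefect w t) ≤ 1 - genFun w (1 - t) := by
  have hf := (genFun_summable hw hs (s := 1 - t) (by linarith) (by linarith)).hasSum
  have hd := (defect_summable hw hm.summable h0).hasSum
  refine hasSum_le (fun k => ?_) ((hm.sub hd).mul_left t) (hs.sub hf)
  have := mul_le_mul_of_nonneg_left (one_sub_pow_ge h0 h1 k) (hw k)
  linarith

/-- Each term is at most 1 until `k ρ^j` drops below 1, which takes about `log k / log ρ⁻¹` indices;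
from there on the terms are dominated by a geometric series. -/
theorem sum_geometric_defect_le {ρ : ℝ} (h0 : 0 < ρ) (h1 : ρ < 1) {k : ℝ} (hk : 1 ≤ k) (n : ℕ) :
    ∑ j ∈ Finset.range n, k * ρ ^ j / (1 + k * ρ ^ j) ≤
      Real.log k / Real.log ρ⁻¹ + 1 + (1 - ρ)⁻¹ := by
  have hl : 0 < Real.log ρ⁻¹ := Real.log_pos ((one_lt_inv₀ h0).2 h1)
  set J := ⌈Real.log k / Real.log ρ⁻¹⌉₊ with hJ
  have hJle : (J : ℝ) ≤ Real.log k / Real.log ρ⁻¹ + 1 :=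
    (Nat.ceil_lt_add_one (div_nonneg (Real.log_nonneg hk) hl.le)).le
  have hkJ : k * ρ ^ J ≤ 1 := by
    have h2 : Real.log k ≤ J * Real.log ρ⁻¹ := (div_le_iff₀ hl).1 (Nat.le_ceil _)
    rw [Real.log_inv] at h2
    have h3 : Real.log (k * ρ ^ J) ≤ 0 := by
      rw [Real.log_mul (by linarith) (by positivity), Real.log_pow]; linarith
    exact (Real.log_nonpos_iff (by positivity)).1 h3
  have hpos : ∀ j, 0 ≤ k * ρ ^ j / (1 + k * ρ ^ j) := fun j => by positivity
  calc ∑ j ∈ Finset.range n, k * ρ ^ j / (1 + k * ρ ^ j)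
      ≤ ∑ j ∈ Finset.range (J + n), k * ρ ^ j / (1 + k * ρ ^ j) :=
        Finset.sum_le_sum_of_subset_of_nonneg
          (Finset.range_subset_range.2 (by omega)) (fun j _ _ => hpos j)
    _ = ∑ j ∈ Finset.range J, k * ρ ^ j / (1 + k * ρ ^ j) +
        ∑ i ∈ Finset.range n, k * ρ ^ (J + i) / (1 + k * ρ ^ (J + i)) := by
        rw [Finset.sum_range_add]
    _ ≤ J + (1 - ρ)⁻¹ := by
        gcongr
        · calc _ ≤ ∑ j ∈ Finset.range J, (1 : ℝ) := by
                refine Finset.sum_le_sum fun j _ => ?_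
                have : (0 : ℝ) ≤ k * ρ ^ j := by positivity
                rw [div_le_one (by linarith)]; linarith
            _ = J := by simp
        · calc _ ≤ ∑ i ∈ Finset.range n, ρ ^ i := by
                refine Finset.sum_le_sum fun i _ => ?_
                have h4 : (0 : ℝ) ≤ k * ρ ^ (J + i) := by positivity
                refine (div_le_self h4 (by linarith)).trans ?_
                rw [pow_add, ← mul_assoc]
                exact mul_le_of_le_one_left (by positivity) hkJ
            _ ≤ (1 - ρ)⁻¹ := by
                rw [← tsum_geometric_of_lt_one h0.le h1]
                exact (summable_geometric_of_lt_one h0.le h1).sum_le_tsum _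
                  (fun i _ => by positivity)
    _ ≤ _ := by linarith

/-- Exchanging the two sums turns the inner one into `O(1 + log k)`, so the `k log k` moment is
exactly what is needed. -/
theorem summable_defect_geometric (hw : ∀ k, 0 ≤ w k) (hm : Summable fun k : ℕ => w k * k)
    (hlog : Summable fun k : ℕ => w k * (k * Real.log k)) {ρ : ℝ} (h0 : 0 < ρ) (h1 : ρ < 1) :
    Summable fun j : ℕ => genFunDefect w (ρ ^ j) := by
  have hB : Summable fun k : ℕ => w k * k * (Real.log k / Real.log ρ⁻¹ + 1 + (1 - ρ)⁻¹) := by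
    refine ((hlog.mul_right (Real.log ρ⁻¹)⁻¹).add (hm.mul_right (1 + (1 - ρ)⁻¹))).congr
      fun k => ?_
    rw [div_eq_mul_inv]; ring
  refine summable_of_sum_range_le (c := ∑' k : ℕ, w k * k *
    (Real.log k / Real.log ρ⁻¹ + 1 + (1 - ρ)⁻¹)) (fun j => defect_nonneg hw (by positivity))
    fun n => ?_
  unfold genFunDefect
  rw [← Summable.tsum_finsetSum fun j _ => defect_summable hw hm (by positivity)]
  refine Summable.tsum_le_tsum (fun k => ?_)
    (summable_sum fun j _ => defect_summable hw hm (by positivity)) hB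
  rw [← Finset.mul_sum]
  rcases Nat.eq_zero_or_pos k with rfl | hk
  · simp
  · exact mul_le_mul_of_nonneg_left
      (sum_geometric_defect_le h0 h1 (by exact_mod_cast hk) n) (mul_nonneg (hw k) k.cast_nonneg)

theorem exp_neg_two_mul_le {x : ℝ} (h0 : 0 ≤ x) (h1 : x ≤ 1 / 2) : Real.exp (-(2 * x)) ≤ 1 - x := by
  rw [Real.exp_neg, inv_le_comm₀ (Real.exp_pos _) (by linarith)]
  have h2 : (1 - x)⁻¹ ≤ 2 * x + 1 := by
    rw [inv_le_iff_one_le_mul₀ (by linarith)]; nlinarith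
  exact h2.trans (Real.add_one_le_exp _)

end GenFun

/-! ### Escape of the iterates from the fixed point 1. -/

section GenFun

variable {w : ℕ → ℝ}

theorem gap_iterate_succ_ge (hw : ∀ k, 0 ≤ w k) (hs : HasSum w 1) {m : ℝ}
    (hm : HasSum (fun k : ℕ => w k * k) m) {s : ℝ} (h : s ∈ Icc (0 : ℝ) 1) (i : ℕ) :
    (1 - (genFun w)^[i] s) * (m - genFunDefect w (1 - (genFun w)^[i] s)) ≤
      1 - (genFun w)^[i + 1] s := by
  have h1 := genFun_iterate_mem hw hs h i
  have := gap_genFun_ge hw hs hm (t := 1 - (genFun w)^[i] s) (by linarith [h1.2])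
    (by linarith [h1.1])
  rwa [sub_sub_cancel, ← Function.iterate_succ_apply' (genFun w) i s] at this

/-- Read backwards in time: as long as the gap stays below `δ`, each step expands it by at least `(1
+ m) / 2`, so `j` steps earlier it was smaller by the `j`-th power of this factor. -/
theorem gap_iterate_le_geometric (hw : ∀ k, 0 ≤ w k) (hs : HasSum w 1) {m : ℝ} (hm1 : 1 < m)
    (hm : HasSum (fun k : ℕ => w k * k) m) {δ : ℝ}
    (hδ : genFunDefect w δ ≤ (m - 1) / 2) {s : ℝ} (h : s ∈ Icc (0 : ℝ) 1) (j : ℕ) :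
    ∀ i, (∀ l ≤ i + j, 1 - (genFun w)^[l] s ≤ δ) →
      1 - (genFun w)^[i] s ≤ δ * (2 / (1 + m)) ^ j := by
  induction j with
  | zero => intro i hi; simpa using hi i le_rfl
  | succ j ih =>
    intro i hi
    have h1 := ih (i + 1) fun l hl => hi l (by omega)
    have h2 := gap_iterate_succ_ge hw hs hm h i
    have h3 := genFun_iterate_mem hw hs h i
    have h4 : genFunDefect w (1 - (genFun w)^[i] s) ≤ (m - 1) / 2 :=
      (defect_mono hw hm.summable (by linarith [h3.2]) (hi i (by omega))).trans hδ
    have h5 : (1 - (genFun w)^[i] s) * ((1 + m) / 2) ≤ 1 - (genFun w)^[i + 1] s :=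
      (mul_le_mul_of_nonneg_left (by linarith) (by linarith [h3.2])).trans h2
    have h6 : 1 - (genFun w)^[i] s ≤ (1 - (genFun w)^[i + 1] s) * (2 / (1 + m)) := by
      rw [← div_le_iff₀ (by positivity), div_div_eq_mul_div, mul_div_assoc]; exact h5
    calc _ ≤ _ := h6
      _ ≤ δ * (2 / (1 + m)) ^ j * (2 / (1 + m)) :=
        mul_le_mul_of_nonneg_right h1 (by positivity)
      _ = _ := by ring

/-- With `x` the defect divided by `m`, the bound `1 - x ≥ exp (-2x)` on `[0, 1/2]` turns the
product of the one-step factors into `m ^ n` times the exponential of a sum of defects. -/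
theorem gap_iterate_ge_prod (hw : ∀ k, 0 ≤ w k) (hs : HasSum w 1) {m : ℝ} (hm1 : 1 < m)
    (hm : HasSum (fun k : ℕ => w k * k) m) {δ : ℝ}
    (hδ : genFunDefect w δ ≤ (m - 1) / 2) {s : ℝ} (h : s ∈ Icc (0 : ℝ) 1) (n : ℕ)
    (hn : ∀ l < n, 1 - (genFun w)^[l] s ≤ δ) :
    (1 - s) * m ^ n *
        Real.exp (-(2 / m * ∑ l ∈ Finset.range n, genFunDefect w (1 - (genFun w)^[l] s))) ≤
      1 - (genFun w)^[n] s := by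
  induction n with
  | zero => simp
  | succ n ih =>
    have h1 := ih fun l hl => hn l (by omega)
    have h2 := gap_iterate_succ_ge hw hs hm h n
    have h3 := genFun_iterate_mem hw hs h n
    set x := 1 - (genFun w)^[n] s with hx
    have hx0 : 0 ≤ x := by linarith [h3.2]
    have h4 : genFunDefect w x ≤ (m - 1) / 2 :=
      (defect_mono hw hm.summable hx0 (hn n (by omega))).trans hδ
    have h5 : m * Real.exp (-(2 / m * genFunDefect w x)) ≤ m - genFunDefect w x := by
      have h6 := exp_neg_two_mul_le (x := genFunDefect w x / m)
        (div_nonneg (defect_nonneg hw hx0) (by linarith))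
        (by rw [div_le_div_iff₀ (by linarith) two_pos]; linarith)
      calc m * Real.exp (-(2 / m * genFunDefect w x))
          = m * Real.exp (-(2 * (genFunDefect w x / m))) := by ring_nf
        _ ≤ m * (1 - genFunDefect w x / m) := mul_le_mul_of_nonneg_left h6 (by linarith)
        _ = m - genFunDefect w x := by field_simp
    rw [Finset.sum_range_succ, mul_add, neg_add, Real.exp_add, ← hx]
    calc _ = ((1 - s) * m ^ n * Real.exp (-(2 / m * ∑ l ∈ Finset.range n,
            genFunDefect w (1 - (genFun w)^[l] s)))) *
            (m * Real.exp (-(2 / m * genFunDefect w x))) := by ring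
      _ ≤ x * (m - genFunDefect w x) :=
          mul_le_mul h1 h5 (by positivity) hx0
      _ ≤ _ := h2

/-- The growth of the Schröder limit `lim f^[n] s / (w 1) ^ n` as `s ↑ 1`, under the
`k log k` condition. -/
theorem genFun_iterate_one_sub_le (hw : ∀ k, 0 ≤ w k) (hs : HasSum w 1) (hz : w 0 = 0)
    (hpos : 0 < w 1) (hlt : w 1 < 1) {m : ℝ} (hm1 : 1 < m)
    (hm : HasSum (fun k : ℕ => w k * k) m)
    (hlog : Summable fun k : ℕ => w k * (k * Real.log k)) {γ : ℝ} (hγ0 : 0 < γ)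
    (hγ : m ^ (-γ) = w 1) :
    ∃ C : ℝ, 0 < C ∧ ∀ t : ℝ, 0 < t → t ≤ 1 →
      ∀ᶠ n in atTop, (genFun w)^[n] (1 - t) ≤ C * t ^ (-γ) * w 1 ^ n := by
  set ρ : ℝ := 2 / (1 + m) with hρ
  have hρ0 : 0 < ρ := by positivity
  have hρ1 : ρ < 1 := by rw [hρ, div_lt_one (by linarith)]; linarith
  have hsum := summable_defect_geometric hw hm.summable hlog hρ0 hρ1
  -- A power of `ρ` at which the defect is at most `(m - 1) / 2`; it serves as the radius `δ` of the
  -- neighbourhood of 1.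
  obtain ⟨J, hJ⟩ := (hsum.tendsto_atTop_zero.eventually_le_const
    (show (0 : ℝ) < (m - 1) / 2 by linarith)).exists
  set δ := ρ ^ J with hδdef
  have hδ0 : 0 < δ := by positivity
  have hδ1 : δ ≤ 1 := pow_le_one₀ hρ0.le hρ1.le
  set H := ∑' j, genFunDefect w (ρ ^ j) with hH
  obtain ⟨C, hC, hCle⟩ := genFun_iterate_le hw hs hz hpos hlt
    (s := 1 - δ) (by linarith) (by linarith)
  -- The factor `m` pays for the last step, which leaves the neighbourhood; the exponential pays for
  -- all defects before it.
  set D : ℝ := m * Real.exp (2 / m * H) with hD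
  have hD0 : 0 < D := by positivity
  have hD1 : 1 ≤ D := by
    have : 0 ≤ H := tsum_nonneg fun j => defect_nonneg hw (by positivity)
    exact one_le_mul_of_one_le_of_one_le hm1.le (Real.one_le_exp (by positivity))
  refine ⟨C * D ^ γ, by positivity, fun t ht0 ht1 => ?_⟩
  have hmem : (1 - t) ∈ Icc (0 : ℝ) 1 := ⟨by linarith, by linarith⟩
  have hex : ∃ n, δ < 1 - (genFun w)^[n] (1 - t) := by
    by_contra! hcon
    have h1 : ∀ j, t ≤ δ * ρ ^ j := fun j => by
      have := gap_iterate_le_geometric hw hs hm1 hm hJ hmem j 0 fun l _ => hcon l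
      simpa using this
    have h2 : Tendsto (fun j => δ * ρ ^ j) atTop (𝓝 (δ * 0)) :=
      (tendsto_pow_atTop_nhds_zero_of_lt_one hρ0.le hρ1).const_mul δ
    have := ge_of_tendsto' h2 h1
    linarith
  classical
  -- The exit time from the `δ`-neighbourhood of 1. The gap is still at most 1 at time `N - 1`,
  -- which forces `m ^ N ≤ D / t`.
  set N := Nat.find hex with hN
  have hNgt : δ < 1 - (genFun w)^[N] (1 - t) := Nat.find_spec hex
  have hNle : ∀ l < N, 1 - (genFun w)^[l] (1 - t) ≤ δ := fun l hl =>
    not_lt.1 (Nat.find_min hex hl)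
  have hmN : m ^ N ≤ D / t := by
    rcases Nat.eq_zero_or_pos N with h0 | h0
    · rw [h0, pow_zero, le_div_iff₀ ht0]; linarith
    · obtain ⟨n, hn⟩ : ∃ n, N = n + 1 := ⟨N - 1, by omega⟩
      have h1 := gap_iterate_ge_prod hw hs hm1 hm hJ hmem n fun l hl => hNle l (by omega)
      rw [sub_sub_cancel] at h1
      have h2 : ∑ l ∈ Finset.range n, genFunDefect w (1 - (genFun w)^[l] (1 - t)) ≤ H := by
        calc _ ≤ ∑ l ∈ Finset.range n, genFunDefect w (ρ ^ (n - 1 - l)) := by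
              refine Finset.sum_le_sum fun l hl => ?_
              have hl' := Finset.mem_range.1 hl
              refine defect_mono hw hm.summable
                (by linarith [(genFun_iterate_mem hw hs hmem l).2]) ?_
              have h3 := gap_iterate_le_geometric hw hs hm1 hm hJ hmem (n - 1 - l) l
                fun i hi => hNle i (by omega)
              exact h3.trans (mul_le_of_le_one_left (by positivity) hδ1)
          _ = ∑ l ∈ Finset.range n, genFunDefect w (ρ ^ l) :=
              Finset.sum_range_reflect (fun l => genFunDefect w (ρ ^ l)) n
          _ ≤ H := hsum.sum_le_tsum _ fun j _ => defect_nonneg hw (by positivity)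
      have h3 : t * m ^ n * Real.exp (-(2 / m * H)) ≤ 1 := by
        refine le_trans ?_ (h1.trans ((hNle n (by omega)).trans hδ1))
        gcongr
      rw [Real.exp_neg, ← div_eq_mul_inv, div_le_one (Real.exp_pos _)] at h3
      rw [hn, le_div_iff₀ ht0, hD, pow_succ]
      nlinarith
  have hm0 : 0 < m := by linarith
  have hwN : (w 1 ^ N)⁻¹ ≤ D ^ γ * t ^ (-γ) := by
    rw [← hγ, ← Real.rpow_natCast, ← Real.rpow_mul hm0.le, ← Real.rpow_neg hm0.le,
      Real.rpow_neg ht0.le, ← div_eq_mul_inv, ← Real.div_rpow hD0.le ht0.le]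
    have : -(-γ * (N : ℝ)) = N * γ := by ring
    rw [this, Real.rpow_mul hm0.le, Real.rpow_natCast]
    exact Real.rpow_le_rpow (by positivity) hmN hγ0.le
  filter_upwards [eventually_ge_atTop N] with n hn
  obtain ⟨l, rfl⟩ := Nat.exists_eq_add_of_le' hn
  -- The first `N` steps bring the iterate below `1 - δ`; the remaining ones decay at rate `w 1`.
  -- The loss `(w 1 ^ N)⁻¹ = m ^ (γN)` is of order `t ^ (-γ)`.
  rw [Function.iterate_add_apply]
  have hbase : (genFun w)^[N] (1 - t) ≤ 1 - δ := by linarith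
  calc (genFun w)^[l] ((genFun w)^[N] (1 - t)) ≤ (genFun w)^[l] (1 - δ) :=
        genFun_iterate_mono hw hs (genFun_iterate_mem hw hs hmem N).1 hbase (by linarith) l
    _ ≤ C * w 1 ^ l := hCle l
    _ = C * (w 1 ^ N)⁻¹ * w 1 ^ (l + N) := by
        rw [pow_add]; field_simp
    _ ≤ C * (D ^ γ * t ^ (-γ)) * w 1 ^ (l + N) := by gcongr
    _ = _ := by ring

end GenFun

/-! ### Markov property and generating functions of the Galton-Watson process. -/

section GaltonWatson

open scoped ENNReal

variable {Ω : Type*}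

/-- The σ-algebra is left free and only generations before `n` are assumed measurable, so that the
lemma also applies to the σ-algebra generated by those generations and to coordinate maps. -/
theorem measurable_galtonWatson_of {mΩ : MeasurableSpace Ω} {ξ : ℕ → ℕ → Ω → ℕ} (n : ℕ)
    (h : ∀ l < n, ∀ i, Measurable (ξ l i)) : Measurable (galtonWatson ξ n) := by
  induction n with
  | zero => exact measurable_const
  | succ n ih =>
    have h1 := ih fun l hl => h l (by omega)
    refine measurable_to_countable' fun k => ?_
    have : galtonWatson ξ (n + 1) ⁻¹' {k} =
        ⋃ j, galtonWatson ξ n ⁻¹' {j} ∩ (fun ω => ∑ i ∈ Finset.range j, ξ n i ω) ⁻¹' {k} := by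
      ext ω
      simp [galtonWatson]
    rw [this]
    refine MeasurableSet.iUnion fun j => (h1 (measurableSet_singleton j)).inter ?_
    exact (Finset.measurable_fun_sum _ fun i _ => h n (by omega) i) (measurableSet_singleton k)

variable [MeasurableSpace Ω] {μ : Measure Ω} {ξ : ℕ → ℕ → Ω → ℕ}

/-- The two variables depend on disjoint blocks of the offspring array: generations before `n`, and
generation `n`. -/
theorem indepFun_galtonWatson_sum (hξm : ∀ n i, Measurable (ξ n i))
    (hξ : iIndepFun (fun j : ℕ × ℕ => ξ j.1 j.2) μ) (n j : ℕ) :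
    IndepFun (galtonWatson ξ n) (fun ω => ∑ i ∈ Finset.range j, ξ n i ω) μ := by
  have hdisj : Disjoint {a : ℕ × ℕ | a.1 < n} {a : ℕ × ℕ | a.1 = n} := by
    rw [Set.disjoint_left]
    intro a ha hb
    simp only [Set.mem_ofPred_eq] at ha hb
    omega
  have hind := indep_iSup_of_disjoint (fun a : ℕ × ℕ => (hξm a.1 a.2).comap_le) hξ hdisj
  have key : ∀ (S : Set (ℕ × ℕ)) (a : ℕ × ℕ), a ∈ S →
      Measurable[⨆ c ∈ S, MeasurableSpace.comap (ξ c.1 c.2) ⊤] (ξ a.1 a.2) := by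
    intro S a ha
    exact (comap_measurable _).mono (le_iSup₂_of_le a ha le_rfl) le_rfl
  refine indep_of_indep_of_le_left (indep_of_indep_of_le_right hind ?_) ?_
  · refine Measurable.comap_le ?_
    exact Finset.measurable_fun_sum _ fun i _ => key {a | a.1 = n} (n, i) rfl
  · refine Measurable.comap_le ?_
    exact measurable_galtonWatson_of n fun l hl i => key {a | a.1 < n} (l, i) hl

/-- The transition probabilities of a Galton-Watson process. -/
noncomputable def galtonWatsonStep (μ : Measure Ω) (ξ : ℕ → ℕ → Ω → ℕ) (j k : ℕ) : ℝ≥0∞ :=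
  μ {ω | ∑ i ∈ Finset.range j, ξ 0 i ω = k}

theorem measure_sum_eq_step [IsProbabilityMeasure μ] {p : PMF ℕ}
    (hξlaw : ∀ n i, HasLaw (ξ n i) p.toMeasure μ)
    (hξ : iIndepFun (fun j : ℕ × ℕ => ξ j.1 j.2) μ) (n j k : ℕ) :
    μ {ω | ∑ i ∈ Finset.range j, ξ n i ω = k} = galtonWatsonStep μ ξ j k := by
  have hrow : ∀ l, iIndepFun (ξ l) μ := fun l =>
    hξ.precomp (g := fun i => (l, i)) fun a b hab => by simpa using hab
  have hid := IdentDistrib.pi (fun i => (⟨(hξlaw n i).aemeasurable, (hξlaw 0 i).aemeasurable,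
    by rw [(hξlaw n i).map_eq, (hξlaw 0 i).map_eq]⟩ : IdentDistrib (ξ n i) (ξ 0 i) μ μ))
    (hrow n) (hrow 0)
  have hs : Measurable fun x : ℕ → ℕ => ∑ i ∈ Finset.range j, x i := by fun_prop
  exact (hid.comp hs).measure_mem_eq (measurableSet_singleton k)

theorem measure_galtonWatson_succ [IsProbabilityMeasure μ] {p : PMF ℕ}
    (hξm : ∀ n i, Measurable (ξ n i)) (hξlaw : ∀ n i, HasLaw (ξ n i) p.toMeasure μ)
    (hξ : iIndepFun (fun j : ℕ × ℕ => ξ j.1 j.2) μ) (n k : ℕ) :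
    μ {ω | galtonWatson ξ (n + 1) ω = k} =
      ∑' j, μ {ω | galtonWatson ξ n ω = j} * galtonWatsonStep μ ξ j k := by
  have hZ := measurable_galtonWatson_of n fun l _ i => hξm l i
  have hS : ∀ j, Measurable fun ω => ∑ i ∈ Finset.range j, ξ n i ω := fun j =>
    Finset.measurable_fun_sum _ fun i _ => hξm n i
  have : {ω | galtonWatson ξ (n + 1) ω = k} =
      ⋃ j, galtonWatson ξ n ⁻¹' {j} ∩ (fun ω => ∑ i ∈ Finset.range j, ξ n i ω) ⁻¹' {k} := by
    ext ω
    simp [galtonWatson]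
  rw [this, measure_iUnion]
  · refine tsum_congr fun j => ?_
    rw [(indepFun_galtonWatson_sum hξm hξ n j).measure_inter_preimage_eq_mul _ _
      (measurableSet_singleton j) (measurableSet_singleton k), ← measure_sum_eq_step hξlaw hξ n j k]
    rfl
  · intro a b hab
    refine Set.disjoint_left.2 fun ω h1 h2 => hab ?_
    exact h1.1.symm.trans h2.1
  · exact fun j => (hZ (measurableSet_singleton j)).inter (hS j (measurableSet_singleton k))

theorem galtonWatsonStep_one [IsProbabilityMeasure μ] {p : PMF ℕ}
    (hξlaw : ∀ n i, HasLaw (ξ n i) p.toMeasure μ) (k : ℕ) : galtonWatsonStep μ ξ 1 k = p k := by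
  have := (hξlaw 0 0).measure_eq (p := fun x => x = k) (measurableSet_singleton k)
  simp only [galtonWatsonStep, Finset.sum_range_one]
  rw [this, ← p.toMeasure_apply_singleton k (measurableSet_singleton k)]
  rfl

/-- Heuristically, the root has a single child with probability `p 1` and the process restarts.
Formally, the inequality holds at `n = 0` and the nonnegative transition kernel propagates it. -/
theorem mul_measure_galtonWatson_le_succ [IsProbabilityMeasure μ] {p : PMF ℕ}
    (hξm : ∀ n i, Measurable (ξ n i)) (hξlaw : ∀ n i, HasLaw (ξ n i) p.toMeasure μ)
    (hξ : iIndepFun (fun j : ℕ × ℕ => ξ j.1 j.2) μ) (n k : ℕ) :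
    p 1 * μ {ω | galtonWatson ξ n ω = k} ≤ μ {ω | galtonWatson ξ (n + 1) ω = k} := by
  induction n generalizing k with
  | zero =>
    by_cases hk : k = 1
    · subst hk
      rw [measure_galtonWatson_succ hξm hξlaw hξ]
      refine le_trans ?_ (ENNReal.le_tsum 1)
      simp [galtonWatson, galtonWatsonStep_one hξlaw]
    · have : {ω : Ω | galtonWatson ξ 0 ω = k} = ∅ := by
        ext ω; simpa [galtonWatson] using fun h => hk h.symm
      rw [this]; simp
  | succ n ih =>
    rw [measure_galtonWatson_succ hξm hξlaw hξ (n + 1), measure_galtonWatson_succ hξm hξlaw hξ n,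
      ← ENNReal.tsum_mul_left]
    refine ENNReal.tsum_le_tsum fun j => ?_
    rw [← mul_assoc]
    exact mul_le_mul_left (ih j) _

theorem lintegral_pow_offspring [IsProbabilityMeasure μ] {p : PMF ℕ}
    (hξlaw : ∀ n i, HasLaw (ξ n i) p.toMeasure μ) (n i : ℕ) {s : ℝ} (h0 : 0 ≤ s) (h1 : s ≤ 1)
    (hp : HasSum (fun k => (p k).toReal) 1) :
    ∫⁻ ω, ENNReal.ofReal s ^ (ξ n i ω) ∂μ =
      ENNReal.ofReal (genFun (fun k => (p k).toReal) s) := by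
  have h2 := (hξlaw n i).lintegral_comp (f := fun k : ℕ => ENNReal.ofReal s ^ k)
    (measurable_of_countable _).aemeasurable
  rw [h2, lintegral_countable', genFun, ENNReal.ofReal_tsum_of_nonneg
    (fun k => by positivity) (genFun_summable (fun k => ENNReal.toReal_nonneg) hp h0 h1)]
  refine tsum_congr fun k => ?_
  rw [p.toMeasure_apply_singleton k (measurableSet_singleton k),
    ENNReal.ofReal_mul ENNReal.toReal_nonneg, ENNReal.ofReal_toReal (p.apply_ne_top k),
    ENNReal.ofReal_pow h0, mul_comm]

theorem tsum_step_mul_pow [IsProbabilityMeasure μ] {p : PMF ℕ}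
    (hξm : ∀ n i, Measurable (ξ n i)) (hξlaw : ∀ n i, HasLaw (ξ n i) p.toMeasure μ)
    (hξ : iIndepFun (fun j : ℕ × ℕ => ξ j.1 j.2) μ) (j : ℕ) {s : ℝ} (h0 : 0 ≤ s) (h1 : s ≤ 1)
    (hp : HasSum (fun k => (p k).toReal) 1) :
    ∑' k, galtonWatsonStep μ ξ j k * ENNReal.ofReal s ^ k =
      ENNReal.ofReal (genFun (fun k => (p k).toReal) s) ^ j := by
  have hrow : iIndepFun (ξ 0) μ :=
    hξ.precomp (g := fun i => (0, i)) fun a b hab => by simpa using hab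
  have hm : Measurable fun k : ℕ => ENNReal.ofReal s ^ k := measurable_of_countable _
  have hpr := lintegral_prod_eq_prod_lintegral_of_indepFun (Finset.range j)
    (fun i ω => ENNReal.ofReal s ^ ξ 0 i ω) (hrow.comp (fun _ k => ENNReal.ofReal s ^ k)
      fun _ => hm) (fun i => hm.comp (hξm 0 i))
  simp only [lintegral_pow_offspring hξlaw 0 _ h0 h1 hp, Finset.prod_const, Finset.card_range,
    Finset.prod_pow_eq_pow_sum] at hpr
  rw [← hpr]
  have hS : Measurable fun ω => ∑ i ∈ Finset.range j, ξ 0 i ω :=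
    Finset.measurable_fun_sum _ fun i _ => hξm 0 i
  rw [← lintegral_map (f := fun k : ℕ => ENNReal.ofReal s ^ k) hm hS, lintegral_countable']
  refine tsum_congr fun k => ?_
  rw [Measure.map_apply hS (measurableSet_singleton k), mul_comm]
  rfl

/-- Summing over the last generation first replaces `s` by `f s`, hence the induction over all `s`.
-/
theorem tsum_galtonWatson_mul_pow [IsProbabilityMeasure μ] {p : PMF ℕ}
    (hξm : ∀ n i, Measurable (ξ n i)) (hξlaw : ∀ n i, HasLaw (ξ n i) p.toMeasure μ)
    (hξ : iIndepFun (fun j : ℕ × ℕ => ξ j.1 j.2) μ)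
    (hp : HasSum (fun k => (p k).toReal) 1) (n : ℕ) {s : ℝ} (h0 : 0 ≤ s) (h1 : s ≤ 1) :
    ∑' k, μ {ω | galtonWatson ξ n ω = k} * ENNReal.ofReal s ^ k =
      ENNReal.ofReal ((genFun fun k => (p k).toReal)^[n] s) := by
  induction n generalizing s with
  | zero =>
    rw [tsum_eq_single 1]
    · simp [galtonWatson]
    · intro k hk
      simp [galtonWatson, hk.symm]
  | succ n ih =>
    have hn : ∀ k, 0 ≤ (p k).toReal := fun k => ENNReal.toReal_nonneg
    rw [Function.iterate_succ_apply, ← ih (genFun_nonneg hn h0) (genFun_le_one hn hp h0 h1)]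
    simp only [measure_galtonWatson_succ hξm hξlaw hξ, ← ENNReal.tsum_mul_right]
    rw [ENNReal.tsum_comm]
    refine tsum_congr fun j => ?_
    simp only [mul_assoc]
    rw [ENNReal.tsum_mul_left, tsum_step_mul_pow hξm hξlaw hξ j h0 h1 hp]

theorem sum_galtonWatson_mul_pow_le [IsProbabilityMeasure μ] {p : PMF ℕ}
    (hξm : ∀ n i, Measurable (ξ n i)) (hξlaw : ∀ n i, HasLaw (ξ n i) p.toMeasure μ)
    (hξ : iIndepFun (fun j : ℕ × ℕ => ξ j.1 j.2) μ)
    (hp : HasSum (fun k => (p k).toReal) 1) (n : ℕ) {s : ℝ} (h0 : 0 ≤ s) (h1 : s ≤ 1)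
    (A : Finset ℕ) :
    ∑ k ∈ A, μ.real {ω | galtonWatson ξ n ω = k} * s ^ k ≤
      (genFun fun k => (p k).toReal)^[n] s := by
  have hn : ∀ k, 0 ≤ (p k).toReal := fun k => ENNReal.toReal_nonneg
  rw [← ENNReal.ofReal_le_ofReal_iff (genFun_iterate_mem hn hp ⟨h0, h1⟩ n).1,
    ← tsum_galtonWatson_mul_pow hξm hξlaw hξ hp n h0 h1,
    ENNReal.ofReal_sum_of_nonneg fun k _ => by positivity]
  refine le_trans (Finset.sum_le_sum fun k _ => ?_) (ENNReal.sum_le_tsum A)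
  rw [ENNReal.ofReal_mul measureReal_nonneg, ENNReal.ofReal_pow h0, measureReal_def,
    ENNReal.ofReal_toReal (measure_ne_top _ _)]

end GaltonWatson

/-! ### The Schröder limits `q` and their partial sums. -/

section Offspring

variable {p : PMF ℕ}

theorem PMF.hasSum_toReal (p : PMF ℕ) : HasSum (fun k => (p k).toReal) 1 := by
  have h : ∑' k, (p k).toReal = 1 := by
    rw [← ENNReal.tsum_toReal_eq p.apply_ne_top, p.tsum_coe, ENNReal.toReal_one]
  exact h ▸ (ENNReal.summable_toReal p.tsum_coe_ne_top).hasSum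

/-- The mean is finite because `k ≤ k log k + 1`. -/
theorem OffspringAssumption.hasSum_mean (hp : OffspringAssumption p) :
    HasSum (fun k : ℕ => (p k).toReal * k) (offspringMean p) := by
  have h : Summable fun k : ℕ => (p k).toReal * k := by
    refine Summable.of_nonneg_of_le (fun k => by positivity) (fun k => ?_)
      (hp.logMoment.add p.hasSum_toReal.summable)
    rcases Nat.eq_zero_or_pos k with rfl | hk
    · simp
    · have hk' : (0 : ℝ) < k := by exact_mod_cast hk
      have h1 := mul_le_mul_of_nonneg_left (Real.one_sub_inv_le_log_of_pos hk') hk'.le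
      rw [mul_sub, mul_one, mul_inv_cancel₀ hk'.ne'] at h1
      have : (0 : ℝ) ≤ (p k).toReal := ENNReal.toReal_nonneg
      nlinarith
  convert h.hasSum using 1
  exact tsum_congr fun k => mul_comm _ _

theorem OffspringAssumption.toReal_pos (hp : OffspringAssumption p) : 0 < (p 1).toReal :=
  ENNReal.toReal_pos hp.one_pos.ne' (p.apply_ne_top 1)

theorem OffspringAssumption.toReal_lt_one (hp : OffspringAssumption p) : (p 1).toReal < 1 := by
  have := (ENNReal.toReal_lt_toReal (p.apply_ne_top 1) ENNReal.one_ne_top).2 hp.one_lt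
  simpa using this

theorem OffspringAssumption.one_lt_mean (hp : OffspringAssumption p) : 1 < offspringMean p := by
  have h1 : HasSum (fun k => (p k).toReal * 2 - if k = 1 then (p 1).toReal else 0)
      (1 * 2 - (p 1).toReal) := (p.hasSum_toReal.mul_right 2).sub (hasSum_ite_eq 1 _)
  have h2 := hasSum_le (fun k => ?_) h1 hp.hasSum_mean
  · linarith [hp.toReal_lt_one]
  · rcases k with _ | _ | k
    · simp [hp.zero]
    · simp; linarith
    · simp only [Nat.reduceEqDiff, if_false, sub_zero]
      refine mul_le_mul_of_nonneg_left ?_ ENNReal.toReal_nonneg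
      push_cast
      linarith [k.cast_nonneg (α := ℝ)]

theorem OffspringAssumption.schroeder_pos (hp : OffspringAssumption p) {γ : ℝ}
    (hγ : offspringMean p ^ (-γ) = (p 1).toReal) : 0 < γ := by
  by_contra! h
  have := Real.one_le_rpow hp.one_lt_mean.le (neg_nonneg.2 h)
  linarith [hp.toReal_lt_one]

theorem OffspringAssumption.rpow_mul (hp : OffspringAssumption p) {γ : ℝ}
    (hγ : offspringMean p ^ (-γ) = (p 1).toReal) (n : ℕ) :
    offspringMean p ^ (γ * n) = ((p 1).toReal ^ n)⁻¹ := by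
  have h0 : 0 ≤ offspringMean p := by linarith [hp.one_lt_mean]
  rw [← hγ, ← Real.rpow_natCast, ← Real.rpow_mul h0, ← Real.rpow_neg h0]
  ring_nf

/-- The limits `q k = lim m ^ (γ n) P(Z_n = k)` exist, are reached from below, and their partial
sums up to `N` are of order `N ^ γ`. -/
theorem exists_schroeder_limit {Ω : Type*} [MeasurableSpace Ω] {μ : Measure Ω}
    [IsProbabilityMeasure μ] (hp : OffspringAssumption p) {ξ : ℕ → ℕ → Ω → ℕ}
    (hξm : ∀ n i, Measurable (ξ n i)) (hξlaw : ∀ n i, HasLaw (ξ n i) p.toMeasure μ)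
    (hξ : iIndepFun (fun j : ℕ × ℕ => ξ j.1 j.2) μ) {γ : ℝ}
    (hγ : offspringMean p ^ (-γ) = (p 1).toReal) :
    ∃ q : ℕ → ℝ, ∃ C : ℝ, 0 < C ∧
      (∀ (n : ℕ) k, offspringMean p ^ (γ * n) * μ.real {ω | galtonWatson ξ n ω = k} ≤ q k) ∧
      (∀ k, Tendsto (fun n : ℕ => offspringMean p ^ (γ * n) *
        μ.real {ω | galtonWatson ξ n ω = k}) atTop (𝓝 (q k))) ∧
      ∀ N : ℕ, 1 ≤ N → ∑ k ∈ Finset.range (N + 1), q k ≤ C * (N : ℝ) ^ γ := by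
  have hp1 := hp.toReal_pos
  have hγ0 := hp.schroeder_pos hγ
  obtain ⟨C, hC, hCle⟩ := genFun_iterate_one_sub_le (w := fun k => (p k).toReal)
    (fun k => ENNReal.toReal_nonneg) p.hasSum_toReal (by simp [hp.zero]) hp1 hp.toReal_lt_one
    hp.one_lt_mean hp.hasSum_mean hp.logMoment hγ0 hγ
  set a : ℕ → ℕ → ℝ := fun n k => offspringMean p ^ (γ * n) *
    μ.real {ω | galtonWatson ξ n ω = k} with ha
  have hmono : ∀ k, Monotone fun n => a n k := by
    intro k
    refine monotone_nat_of_le_succ fun n => ?_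
    have h := ENNReal.toReal_mono (measure_ne_top _ _)
      (mul_measure_galtonWatson_le_succ hξm hξlaw hξ n k)
    rw [ENNReal.toReal_mul] at h
    simp only [ha, hp.rpow_mul hγ]
    rw [pow_succ, mul_inv, mul_assoc]
    refine mul_le_mul_of_nonneg_left ?_ (by positivity)
    rw [← div_eq_inv_mul, le_div_iff₀ hp1, mul_comm]
    exact h
  have hbound : ∀ N : ℕ, 1 ≤ N → ∀ n,
      ∑ k ∈ Finset.range (N + 1), a n k ≤ 2 * C * 2 ^ γ * (N : ℝ) ^ γ := by
    intro N hN n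
    have hN' : (1 : ℝ) ≤ N := by exact_mod_cast hN
    have ht1 : ((2 * N : ℝ))⁻¹ ≤ 1 := inv_le_one_of_one_le₀ (by linarith)
    -- The generating function bound holds only beyond a threshold depending on `N`; monotonicity in
    -- the generation allows passing from `n` to a later `n'`.
    obtain ⟨n', hn', hnn⟩ := ((hCle (2 * N : ℝ)⁻¹ (by positivity) ht1).and
      (eventually_ge_atTop n)).exists
    have h1 := (sum_galtonWatson_mul_pow_le hξm hξlaw hξ p.hasSum_toReal n'
      (s := 1 - (2 * N : ℝ)⁻¹) (by linarith) (by linarith [show (0:ℝ) ≤ (2 * N : ℝ)⁻¹ by positivity])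
      (Finset.range (N + 1))).trans hn'
    calc ∑ k ∈ Finset.range (N + 1), a n k ≤ ∑ k ∈ Finset.range (N + 1), a n' k :=
          Finset.sum_le_sum fun k _ => hmono k hnn
      _ ≤ ∑ k ∈ Finset.range (N + 1), ((p 1).toReal ^ n')⁻¹ * (2 *
            (μ.real {ω | galtonWatson ξ n' ω = k} * (1 - (2 * N : ℝ)⁻¹) ^ k)) := by
          refine Finset.sum_le_sum fun k hk => ?_
          simp only [ha, hp.rpow_mul hγ]
          refine mul_le_mul_of_nonneg_left ?_ (by positivity)
          have hkN : (k : ℝ) ≤ N := by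
            exact_mod_cast Nat.lt_succ_iff.1 (Finset.mem_range.1 hk)
          have h2 := one_add_mul_le_pow (a := -(2 * N : ℝ)⁻¹) (by linarith) k
          have h3 : (k : ℝ) * (2 * N : ℝ)⁻¹ ≤ 1 / 2 := by
            rw [← div_eq_mul_inv, div_le_div_iff₀ (by positivity) two_pos]; linarith
          -- At `s = 1 - 1 / (2N)` Bernoulli gives `s ^ k ≥ 1/2` for `k ≤ N`, so the partial sum is
          -- at most twice the generating function.
          have h4 : 1 / 2 ≤ (1 - (2 * N : ℝ)⁻¹) ^ k := by
            rw [← sub_eq_add_neg] at h2; linarith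
          nlinarith [measureReal_nonneg (μ := μ) (s := {ω | galtonWatson ξ n' ω = k})]
      _ = ((p 1).toReal ^ n')⁻¹ * 2 * ∑ k ∈ Finset.range (N + 1),
            (μ.real {ω | galtonWatson ξ n' ω = k} * (1 - (2 * N : ℝ)⁻¹) ^ k) := by
          rw [Finset.mul_sum]
          exact Finset.sum_congr rfl fun k _ => by ring
      _ ≤ ((p 1).toReal ^ n')⁻¹ * 2 * (C * ((2 * N : ℝ)⁻¹) ^ (-γ) * (p 1).toReal ^ n') := by
          gcongr
      _ = 2 * C * 2 ^ γ * (N : ℝ) ^ γ := by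
          rw [Real.inv_rpow (by positivity), Real.rpow_neg (by positivity), inv_inv,
            Real.mul_rpow (by positivity) (by positivity)]
          field_simp
  have ha0 : ∀ n k, 0 ≤ a n k := fun n k => by
    have := hp.one_lt_mean
    simp only [ha]; positivity
  have hbdd : ∀ k, BddAbove (range fun n => a n k) := by
    intro k
    refine ⟨2 * C * 2 ^ γ * ((k + 1 : ℕ) : ℝ) ^ γ, ?_⟩
    rintro _ ⟨n, rfl⟩
    exact (Finset.single_le_sum (f := fun k => a n k) (fun j _ => ha0 n j)
      (Finset.mem_range.2 (by omega : k < k + 1 + 1))).trans (hbound (k + 1) (by omega) n)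
  have htend : ∀ k, Tendsto (fun n => a n k) atTop (𝓝 (⨆ n, a n k)) := fun k =>
    tendsto_atTop_ciSup (hmono k) (hbdd k)
  refine ⟨fun k => ⨆ n, a n k, 2 * C * 2 ^ γ, by positivity, fun n k => le_ciSup (hbdd k) n,
    htend, fun N hN => ?_⟩
  exact le_of_tendsto' (tendsto_finsetSum _ fun k _ => htend k) (hbound N hN)

end Offspring

/-! ### Large deviations of the random walk: one big jump. -/

section Deviation

/-- A Taylor remainder of order `r` between 1 and 2, usable when the second moment is infinite. For
`|x| ≤ 1` it dominates the quadratic remainder; for `|x| ≥ 1` it dominates `exp x` or `|x|`. -/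
theorem exp_le_one_add_add_rpow {r : ℝ} (h1 : 1 ≤ r) (h2 : r ≤ 2) (x : ℝ) :
    Real.exp x ≤ 1 + x + |x| ^ r * Real.exp (max x 0) := by
  rcases le_total |x| 1 with hx | hx
  · have h3 := (abs_le.1 (Real.abs_exp_sub_one_sub_id_le hx)).2
    have h4 : x ^ 2 ≤ |x| ^ r := by
      rw [← sq_abs, ← Real.rpow_natCast]
      exact Real.rpow_le_rpow_of_exponent_ge' (abs_nonneg x) hx (by linarith) (by simpa using h2)
    have h5 : |x| ^ r * 1 ≤ |x| ^ r * Real.exp (max x 0) :=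
      mul_le_mul_of_nonneg_left (Real.one_le_exp (le_max_right _ _)) (by positivity)
    linarith
  · have h4 : |x| ≤ |x| ^ r := Real.self_le_rpow_of_one_le hx h1
    rcases le_total 0 x with h0 | h0
    · rw [max_eq_left h0]
      have : 1 * Real.exp x ≤ |x| ^ r * Real.exp x :=
        mul_le_mul_of_nonneg_right (hx.trans h4) (Real.exp_pos _).le
      linarith
    · rw [max_eq_right h0, Real.exp_zero, mul_one]
      rw [abs_of_nonpos h0] at h4 ⊢
      have := Real.exp_le_one_iff.2 h0
      linarith

variable {Ω : Type*} [MeasurableSpace Ω] {μ : Measure Ω} [IsProbabilityMeasure μ]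
  {ν : Measure ℝ} {X : ℕ → Ω → ℝ}

/-- A union bound over the large summands, and an exponential Chebyshev inequality for the sum of
the truncated ones. -/
theorem partialSum_tail_le (hXm : ∀ i, Measurable (X i)) (hXlaw : ∀ i, HasLaw (X i) ν μ)
    (hX : iIndepFun X μ) [IsProbabilityMeasure ν] (k : ℕ) {M y h : ℝ} (hh : 0 ≤ h)
    (a : ℝ) :
    μ.real {ω | a ≤ partialSum X k ω} ≤ k * ν.real (Ioi y) +
      Real.exp (-h * a) * (∫ x, Real.exp (h * min (max x (-M)) y) ∂ν) ^ k := by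
  -- Raising values to `-M` only increases the sum, and capping at `y` changes nothing unless some
  -- summand exceeds `y`.
  set T : ℝ → ℝ := fun x => min (max x (-M)) y with hT
  have hTm : Measurable T := by fun_prop
  have hTb : ∀ x, T x ≤ y := fun x => min_le_right _ _
  have hint : Integrable (fun ω => Real.exp (h * ∑ i ∈ Finset.range k, T (X i ω))) μ := by
    refine Integrable.of_bound (C := Real.exp (h * (k * y))) ?_ (ae_of_all _ fun ω => ?_)
    · have : ∀ i, Measurable fun ω => T (X i ω) := fun i => hTm.comp (hXm i)
      fun_prop
    · rw [Real.norm_eq_abs, Real.abs_exp]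
      gcongr
      exact (Finset.sum_le_card_nsmul _ _ _ fun i _ => hTb _).trans (by simp)
  have hcher := measure_ge_le_exp_mul_mgf (μ := μ) (X := fun ω => ∑ i ∈ Finset.range k, T (X i ω))
    a hh hint
  have hmgf : mgf (fun ω => ∑ i ∈ Finset.range k, T (X i ω)) μ h =
      (∫ x, Real.exp (h * T x) ∂ν) ^ k := by
    have h1 := (hX.comp (fun _ => T) fun _ => hTm).mgf_sum (t := h)
      (fun i => hTm.comp (hXm i)) (Finset.range k)
    have h2 : (∑ i ∈ Finset.range k, T ∘ X i) = fun ω => ∑ i ∈ Finset.range k, T (X i ω) := by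
      ext ω; simp
    rw [h2] at h1
    rw [h1, Finset.prod_congr rfl (g := fun _ => ∫ x, Real.exp (h * T x) ∂ν)]
    · simp
    · intro i _
      exact (hXlaw i).integral_comp (f := fun x => Real.exp (h * T x))
        (by fun_prop)
  rw [hmgf] at hcher
  have hsub : {ω | a ≤ partialSum X k ω} ⊆
      (⋃ i ∈ Finset.range k, {ω | X i ω ∈ Ioi y}) ∪
        {ω | a ≤ ∑ i ∈ Finset.range k, T (X i ω)} := by
    intro ω hω
    by_cases hc : ∃ i ∈ Finset.range k, y < X i ω
    · left
      simpa using hc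
    · right
      push Not at hc
      have hω' : a ≤ ∑ i ∈ Finset.range k, X i ω := hω
      refine hω'.trans (Finset.sum_le_sum fun i hi => ?_)
      exact le_min (le_max_left _ _) (hc i hi)
  refine (measureReal_mono hsub).trans ((measureReal_union_le _ _).trans (add_le_add ?_ hcher))
  refine (measureReal_biUnion_finset_le _ _).trans ?_
  rw [Finset.sum_congr rfl fun i _ => (hXlaw i).measureReal_eq (p := fun x => x ∈ Ioi y)
    measurableSet_Ioi]
  simp only [Finset.sum_const, Finset.card_range, nsmul_eq_mul]
  rfl

/-- Since `h ≥ 0`, the cap `y` can be dropped from the linear term and from the power; it survives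
only in `exp (h * y)`. -/
theorem integral_exp_truncated_le [IsProbabilityMeasure ν] {M : ℝ} {r : ℝ} (h1 : 1 ≤ r)
    (h2 : r ≤ 2) (hr : Integrable (fun x => |max x (-M)| ^ r) ν)
    (hi : Integrable (fun x => max x (-M)) ν) {h y : ℝ} (hh : 0 ≤ h) (hy : 0 ≤ y) :
    ∫ x, Real.exp (h * min (max x (-M)) y) ∂ν ≤
      1 + h * ∫ x, max x (-M) ∂ν + h ^ r * Real.exp (h * y) * ∫ x, |max x (-M)| ^ r ∂ν := by
  have hR : Integrable (fun x => 1 + h * max x (-M) + h ^ r * Real.exp (h * y) *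
      |max x (-M)| ^ r) ν := ((integrable_const 1).add (hi.const_mul h)).add (hr.const_mul _)
  have hL : Integrable (fun x => Real.exp (h * min (max x (-M)) y)) ν := by
    refine Integrable.of_bound (C := Real.exp (h * y)) (by fun_prop) (ae_of_all _ fun x => ?_)
    rw [Real.norm_eq_abs, Real.abs_exp]
    gcongr
    exact min_le_right _ _
  refine (integral_mono hL hR fun x => ?_).trans_eq ?_
  · set u := max x (-M)
    have h3 : |min u y| ≤ |u| := by
      rcases le_total u y with h | h
      · rw [min_eq_left h]
      · rw [min_eq_right h, abs_of_nonneg hy, abs_of_nonneg (hy.trans h)]; exact h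
    have h4 : max (h * min u y) 0 ≤ h * y :=
      max_le (mul_le_mul_of_nonneg_left (min_le_right _ _) hh) (mul_nonneg hh hy)
    refine (exp_le_one_add_add_rpow h1 h2 _).trans ?_
    rw [abs_mul, abs_of_nonneg hh, Real.mul_rpow hh (abs_nonneg _)]
    have h5 : h ^ r * |min u y| ^ r * Real.exp (max (h * min u y) 0) ≤
        h ^ r * |u| ^ r * Real.exp (h * y) := by
      gcongr
    have h6 : h * min u y ≤ h * u := mul_le_mul_of_nonneg_left (min_le_left _ _) hh
    show 1 + h * min u y + h ^ r * |min u y| ^ r * Real.exp (max (h * min u y) 0) ≤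
      1 + h * u + h ^ r * Real.exp (h * y) * |u| ^ r
    linarith
  · have h3 : Integrable (fun x => 1 + h * max x (-M)) ν :=
      (integrable_const 1).add (hi.const_mul h)
    rw [integral_add h3 (hr.const_mul _), integral_add (integrable_const 1) (hi.const_mul h), integral_const_mul, integral_const_mul]
    simp

/-- One big jump bound: the probability that the walk exceeds its drift linearly is at most
`k P(X > c k)`, up to an arbitrarily small power of `k`. -/
theorem exists_partialSum_tail_le (hXm : ∀ i, Measurable (X i)) (hXlaw : ∀ i, HasLaw (X i) ν μ)
    (hX : iIndepFun X μ) [IsProbabilityMeasure ν] {M r ε κ : ℝ} (h1 : 1 < r)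
    (h2 : r ≤ 2) (hr : Integrable (fun x => |max x (-M)| ^ r) ν)
    (hi : Integrable (fun x => max x (-M)) ν) (hε : 0 < ε) (hκ : 0 < κ)
    (hmean : ∫ x, max x (-M) ∂ν ≤ ε / 2) :
    ∃ c : ℝ, 0 < c ∧ ∀ᶠ k : ℕ in atTop,
      μ.real {ω | ε * k ≤ partialSum X k ω} ≤ k * ν.real (Ioi (c * k)) + (k : ℝ) ^ (-κ) := by
  -- With `h = A log k / k`, the exponent left after spending `3ε/4` of the drift is `-hεk/4 = -κ
  -- log k`.
  set A : ℝ := 4 * κ / ε with hA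
  have hA0 : 0 < A := by positivity
  -- This makes `exp (h c k) = k ^ ((r - 1) / 2)`, which uses up only half of the power of `k`
  -- gained from `h ^ (r - 1)`.
  set c : ℝ := (r - 1) / (2 * A) with hc
  have hr1 : 0 < r - 1 := by linarith
  have hc0 : 0 < c := by positivity
  set D : ℝ := ∫ x, |max x (-M)| ^ r ∂ν with hD
  have hD0 : 0 ≤ D := integral_nonneg fun x => by positivity
  refine ⟨c, hc0, ?_⟩
  have hlim : Tendsto (fun x : ℝ => D * A ^ (r - 1) * (Real.log x / x ^ (1 / 2 : ℝ)) ^ (r - 1))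
      atTop (𝓝 0) := by
    have := ((isLittleO_log_rpow_atTop (r := 1 / 2) (by norm_num)).tendsto_div_nhds_zero.rpow_const
      (p := r - 1) (Or.inr hr1.le)).const_mul (D * A ^ (r - 1))
    simpa [Real.zero_rpow hr1.ne'] using this
  have hev := (hlim.comp (tendsto_natCast_atTop_atTop (R := ℝ))).eventually_le_const
    (show (0 : ℝ) < ε / 4 by positivity)
  filter_upwards [hev, eventually_ge_atTop 2] with k hk hk2
  have hk2' : (2 : ℝ) ≤ k := by exact_mod_cast hk2
  have hk0 : (0 : ℝ) < k := by linarith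
  have hlog : 0 < Real.log k := Real.log_pos (by linarith)
  set h : ℝ := A * Real.log k / k with hh
  have hh0 : 0 < h := by positivity
  have hb := partialSum_tail_le hXm hXlaw hX k (M := M) (y := c * k) hh0.le (ε * k)
  refine hb.trans (add_le_add le_rfl ?_)
  have hI := integral_exp_truncated_le h1.le h2 hr hi hh0.le (y := c * k) (by positivity)
  have hexp : Real.exp (h * (c * k)) = (k : ℝ) ^ ((r - 1) / 2) := by
    rw [Real.rpow_def_of_pos hk0]
    congr 1
    rw [hh, hc]
    field_simp
  have hsmall : h ^ r * Real.exp (h * (c * k)) * D ≤ h * (ε / 4) := by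
    have e : h ^ r * Real.exp (h * (c * k)) * D =
        h * (D * A ^ (r - 1) * (Real.log k / (k : ℝ) ^ (1 / 2 : ℝ)) ^ (r - 1)) := by
      have e1 : h ^ r = h * h ^ (r - 1) := by
        rw [← Real.rpow_one_add' hh0.le (by linarith)]; ring_nf
      have e2 : h ^ (r - 1) * (k : ℝ) ^ ((r - 1) / 2) =
          A ^ (r - 1) * (Real.log k / (k : ℝ) ^ (1 / 2 : ℝ)) ^ (r - 1) := by
        rw [hh, Real.div_rpow (by positivity) hk0.le, Real.mul_rpow hA0.le hlog.le,
          Real.div_rpow hlog.le (by positivity), ← Real.rpow_mul hk0.le]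
        have e3 : (k : ℝ) ^ (r - 1) = (k : ℝ) ^ ((r - 1) / 2) * (k : ℝ) ^ (1 / 2 * (r - 1)) := by
          rw [← Real.rpow_add hk0]; ring_nf
        rw [e3]
        field_simp
      rw [hexp, e1]
      calc h * h ^ (r - 1) * (k : ℝ) ^ ((r - 1) / 2) * D
          = h * (h ^ (r - 1) * (k : ℝ) ^ ((r - 1) / 2)) * D := by ring
        _ = _ := by rw [e2]; ring
    rw [e]
    exact mul_le_mul_of_nonneg_left hk hh0.le
  -- The truncated mean contributes `ε/2` and the remainder `ε/4`.
  have hI2 : ∫ x, Real.exp (h * min (max x (-M)) (c * k)) ∂ν ≤ Real.exp (h * (3 * ε / 4)) := by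
    have h3 : h * ∫ x, max x (-M) ∂ν ≤ h * (ε / 2) := mul_le_mul_of_nonneg_left hmean hh0.le
    have h4 := Real.add_one_le_exp (h * (3 * ε / 4))
    linarith
  calc Real.exp (-h * (ε * k)) * (∫ x, Real.exp (h * min (max x (-M)) (c * k)) ∂ν) ^ k
      ≤ Real.exp (-h * (ε * k)) * Real.exp (h * (3 * ε / 4)) ^ k := by
        gcongr
    _ = (k : ℝ) ^ (-κ) := by
        rw [← Real.exp_nat_mul, ← Real.exp_add, Real.rpow_def_of_pos hk0]
        congr 1
        rw [hh, hA]
        field_simp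
        norm_num

end Deviation

/-! ### Centring and moments of the step law. -/

section StepLaw

variable {Ω : Type*} [MeasurableSpace Ω] {μ : Measure Ω} [IsProbabilityMeasure μ]
  {ν : Measure ℝ} {X : ℕ → Ω → ℝ}

/-- An integrable law whose normalised sums have a nondegenerate weak limit has mean zero. -/
theorem mean_eq_zero_of_attracted (hXm : ∀ i, Measurable (X i)) (hXlaw : ∀ i, HasLaw (X i) ν μ)
    (hX : iIndepFun X μ) (hint : Integrable (fun x : ℝ => x) ν) {b : ℝ → ℝ}
    (hb : ∀ x, 0 < x → 0 < b x) {ρ : Measure ℝ} [IsProbabilityMeasure ρ]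
    (hρ : ∀ x, ρ ≠ Measure.dirac x)
    (hattr : TendstoInDistribution (fun (k : ℕ) ω => partialSum X k ω / b k) atTop
      (id : ℝ → ℝ) (fun _ => μ) ρ) : ∫ x, x ∂ν = 0 := by
  by_contra hne
  set e := ∫ x, x ∂ν with he
  have hlln : ∀ᵐ ω ∂μ, Tendsto (fun n : ℕ => partialSum X n ω / n) atTop (𝓝 e) := by
    have h1 := strong_law_ae_real X
      (Integrable.comp_measurable (g := fun x : ℝ => x) ((hXlaw 0).map_eq.symm ▸ hint) (hXm 0))
      (fun i j hij => hX.indepFun hij)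
      (fun i => ⟨(hXlaw i).aemeasurable, (hXlaw 0).aemeasurable,
        by rw [(hXlaw i).map_eq, (hXlaw 0).map_eq]⟩)
    rw [(hXlaw 0).integral_eq] at h1
    exact h1
  set R : ℕ → ℝ := fun k => k / b k with hR
  have hS : ∀ ω k, 1 ≤ k → partialSum X k ω / k * R k = partialSum X k ω / b k := by
    intro ω k hk
    have hk' : (0 : ℝ) < k := by exact_mod_cast hk
    have := hb k hk'
    simp only [hR]
    field_simp
  have hsub : ∀ φ : ℕ → ℕ, StrictMono φ →
      TendstoInDistribution (fun (k : ℕ) ω => partialSum X (φ k) ω / b (φ k)) atTop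
        (id : ℝ → ℝ) (fun _ => μ) ρ := fun φ hφ =>
    ⟨fun i => hattr.forall_aemeasurable (φ i), hattr.aemeasurable_limit,
      hattr.tendsto.comp hφ.tendsto_atTop⟩
  -- By the strong law, `S_k / b k` behaves like `e * (k / b k)` with `e ≠ 0`. If `k / b k` tends to
  -- infinity, mass escapes: `exp (-|·|)` of the ratio tends to 0, while under `ρ` it is positive.
  by_cases hinf : Tendsto R atTop atTop
  · set g : ℝ → ℝ := fun x => Real.exp (-|x|) with hg
    have hgc : Continuous g := by fun_prop
    have h1 := hattr.continuous_comp hgc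
    have h2 : TendstoInDistribution (fun (k : ℕ) => g ∘ fun ω => partialSum X k ω / b k) atTop
        (fun _ : Ω => (0 : ℝ)) (fun _ => μ) μ := by
      refine tendstoInDistribution_of_ae_tendsto h1.forall_aemeasurable aemeasurable_const ?_
      filter_upwards [hlln] with ω hω
      have h3 : Tendsto (fun k => |partialSum X k ω / k| * R k) atTop atTop :=
        (hω.abs).pos_mul_atTop (abs_pos.2 hne) hinf
      have h4 := Real.tendsto_exp_neg_atTop_nhds_zero.comp h3
      refine h4.congr' ?_
      filter_upwards [eventually_ge_atTop 1] with k hk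
      have hk' : (0 : ℝ) < k := by exact_mod_cast hk
      have hR0 : 0 ≤ R k := div_nonneg hk'.le (hb k hk').le
      simp only [hg, Function.comp_apply]
      rw [← hS ω k hk, abs_mul, abs_of_nonneg hR0]
    have h3 := tendstoInDistribution_unique _ h1 h2
    have h4 : (ρ.map (g ∘ id)) {0} = 0 := by
      rw [Measure.map_apply (by fun_prop) (measurableSet_singleton 0)]
      have : (g ∘ id) ⁻¹' {0} = ∅ := by
        ext x; simp [hg]
      rw [this, measure_empty]
    rw [h3, Measure.map_const, measure_univ, one_smul] at h4
    simp at h4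
  · obtain ⟨B, hB⟩ : ∃ B, ∃ᶠ k in atTop, R k < B := by
      rw [tendsto_atTop] at hinf
      push Not at hinf
      exact hinf
    have hfreq : ∃ᶠ k in atTop, R k ∈ Icc 0 B := by
      refine (hB.and_eventually (eventually_ge_atTop 1)).mono fun k hk => ⟨?_, hk.1.le⟩
      have hk' : (0 : ℝ) < k := by exact_mod_cast hk.2
      exact div_nonneg hk'.le (hb k hk').le
    -- Otherwise `k / b k` converges along a subsequence and the weak limit is the constant `e * l`,
    -- against nondegeneracy.
    obtain ⟨l, -, φ, hφ, hl⟩ := isCompact_Icc.tendsto_subseq' hfreq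
    have h1 := hsub φ hφ
    have h2 : TendstoInDistribution (fun (k : ℕ) ω => partialSum X (φ k) ω / b (φ k)) atTop
        (fun _ : Ω => e * l) (fun _ => μ) μ := by
      refine tendstoInDistribution_of_ae_tendsto h1.forall_aemeasurable aemeasurable_const ?_
      filter_upwards [hlln] with ω hω
      have h3 := (hω.comp hφ.tendsto_atTop).mul hl
      refine h3.congr' ?_
      filter_upwards [eventually_ge_atTop 1] with k hk
      exact hS ω (φ k) (hk.trans hφ.le_apply)
    have h3 := tendstoInDistribution_unique _ h1 h2
    rw [Measure.map_id, Measure.map_const, measure_univ, one_smul] at h3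
    exact hρ _ h3

/-- If the positive part is integrable and the mean, when it exists, is nonpositive, then cutting
off the large negative values leaves an arbitrarily small mean. -/
theorem exists_integral_max_le [IsProbabilityMeasure ν] (hpos : Integrable (fun x => max x 0) ν)
    (hmean : Integrable (fun x : ℝ => x) ν → ∫ x, x ∂ν ≤ 0) {η : ℝ} (hη : 0 < η) :
    ∃ M : ℝ, 0 < M ∧ ∫ x, max x (-M) ∂ν ≤ η := by
  by_cases hint : Integrable (fun x : ℝ => x) ν
  · have h1 : Tendsto (fun n : ℕ => ∫ x, max x (-(n : ℝ)) ∂ν) atTop (𝓝 (∫ x, x ∂ν)) := by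
      refine tendsto_integral_of_dominated_convergence (fun x => |x|)
        (fun n => by fun_prop) hint.abs (fun n => ae_of_all _ fun x => ?_)
        (ae_of_all _ fun x => ?_)
      · rw [Real.norm_eq_abs, abs_le]
        have hn : (0 : ℝ) ≤ n := n.cast_nonneg
        exact ⟨(neg_abs_le x).trans (le_max_left _ _),
          max_le (le_abs_self x) (by linarith [abs_nonneg x])⟩
      · refine tendsto_const_nhds.congr' ?_
        filter_upwards [eventually_ge_atTop ⌈-x⌉₊] with n hn
        have : -x ≤ n := (Nat.le_ceil _).trans (by exact_mod_cast hn)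
        exact (max_eq_left (by linarith)).symm
    have h2 := h1.eventually (gt_mem_nhds ((hmean hint).trans_lt hη))
    obtain ⟨n, hn, hn1⟩ := (h2.and (eventually_ge_atTop 1)).exists
    exact ⟨n, by exact_mod_cast hn1, hn.le⟩
  -- Here the mean is `-∞`. If every truncated mean exceeded `η`, the negative part would have
  -- integral at most that of the positive part, and the law would be integrable.
  · by_contra! hcon
    refine hint ?_
    have hneg : Integrable (fun x : ℝ => max (-x) 0) ν := by
      have hI : ∀ n : ℕ, Integrable (fun x : ℝ => min (max (-x) 0) n) ν := fun n => by
        refine Integrable.of_bound (C := n) (by fun_prop) (ae_of_all _ fun x => ?_)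
        rw [Real.norm_eq_abs, abs_of_nonneg (le_min (le_max_right _ _) n.cast_nonneg)]
        exact min_le_right _ _
      have hle : ∀ n : ℕ, 1 ≤ n → ∫ x, min (max (-x) 0) n ∂ν ≤ ∫ x, max x 0 ∂ν := by
        intro n hn
        have h1 := hcon n (by exact_mod_cast hn)
        have h2 : ∫ x, max x (-(n : ℝ)) ∂ν =
            ∫ x, max x 0 ∂ν - ∫ x, min (max (-x) 0) n ∂ν := by
          rw [← integral_sub hpos (hI n)]
          refine integral_congr_ae (ae_of_all _ fun x => ?_)
          have hn0 : (0 : ℝ) ≤ n := n.cast_nonneg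
          show max x (-(n : ℝ)) = max x 0 - min (max (-x) 0) n
          rcases le_total 0 x with hx | hx
          · rw [max_eq_left hx, max_eq_right (neg_nonpos.2 hx), min_eq_left hn0,
              max_eq_left (by linarith), sub_zero]
          · rw [max_eq_right hx, max_eq_left (neg_nonneg.2 hx)]
            rcases le_total (-x) n with h | h
            · rw [min_eq_left h, max_eq_left (by linarith)]; ring
            · rw [min_eq_right h, max_eq_right (by linarith)]; ring
        linarith
      refine ⟨by fun_prop, ?_⟩
      rw [hasFiniteIntegral_iff_ofReal (ae_of_all _ fun x => le_max_right (-x) 0)]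
      have ht : Tendsto (fun n : ℕ => ∫⁻ x, ENNReal.ofReal (min (max (-x) 0) n) ∂ν) atTop
          (𝓝 (∫⁻ x, ENNReal.ofReal (max (-x) 0) ∂ν)) := by
        refine lintegral_tendsto_of_tendsto_of_monotone (fun n => by fun_prop)
          (ae_of_all _ fun x n n' h => ?_) (ae_of_all _ fun x => ?_)
        · refine ENNReal.ofReal_le_ofReal (min_le_min le_rfl ?_)
          exact_mod_cast h
        · refine tendsto_const_nhds.congr' ?_
          filter_upwards [eventually_ge_atTop ⌈max (-x) 0⌉₊] with n hn
          rw [min_eq_left ((Nat.le_ceil _).trans (by exact_mod_cast hn))]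
      refine lt_of_le_of_lt (le_of_tendsto ht ?_)
        (ENNReal.ofReal_lt_top (r := ∫ x, max x 0 ∂ν))
      filter_upwards [eventually_ge_atTop 1] with n hn
      rw [← ofReal_integral_eq_lintegral_ofReal (hI n)
        (ae_of_all _ fun x => le_min (le_max_right _ _) n.cast_nonneg)]
      exact ENNReal.ofReal_le_ofReal (hle n hn)
    refine (hpos.sub hneg).congr (ae_of_all _ fun x => ?_)
    show max x 0 - max (-x) 0 = x
    rcases le_total 0 x with hx | hx
    · rw [max_eq_left hx, max_eq_right (neg_nonpos.2 hx), sub_zero]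
    · rw [max_eq_right hx, max_eq_left (neg_nonneg.2 hx)]; ring

theorem integrable_abs_max_rpow [IsProbabilityMeasure ν] {κ r : ℝ}
    (h : IntegrableOn (fun x : ℝ => x ^ κ) (Ioi 0) ν) (h0 : 0 ≤ r) (hr : r ≤ κ) {M : ℝ}
    (hM : 0 ≤ M) : Integrable (fun x => |max x (-M)| ^ r) ν := by
  have h1 : Integrable (fun x => M ^ r + 1 + (Ioi (0 : ℝ)).indicator (fun x : ℝ => x ^ κ) x) ν :=
    (integrable_const _).add ((integrable_indicator_iff measurableSet_Ioi).2 h)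
  refine h1.mono' (by fun_prop) (ae_of_all _ fun x => ?_)
  rw [Real.norm_eq_abs, abs_of_nonneg (by positivity)]
  have hMr : 0 ≤ M ^ r := by positivity
  rcases le_or_gt x 0 with hx | hx
  · rw [indicator_of_notMem (by simpa using hx), add_zero]
    have : |max x (-M)| ≤ M := by
      rw [abs_le]
      exact ⟨le_max_right _ _, max_le (hx.trans hM) (by linarith)⟩
    linarith [Real.rpow_le_rpow (abs_nonneg _) this h0]
  · rw [indicator_of_mem (mem_Ioi.2 hx), max_eq_left (by linarith), abs_of_pos hx]
    rcases le_total x 1 with h2 | h2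
    · have := Real.rpow_le_one hx.le h2 h0
      have : 0 ≤ x ^ κ := by positivity
      linarith
    · have := Real.rpow_le_rpow_of_exponent_le h2 hr
      linarith

/-- A regularly varying upper tail of index `β` has all positive-part moments below `β`. -/
theorem integrableOn_rpow_of_tail [IsProbabilityMeasure ν] {α β κ : ℝ} {L : ℝ → ℝ}
    (hA : StepTailAssumption ν α β L) (hκ : 0 < κ) (hκβ : κ < β) :
    IntegrableOn (fun x : ℝ => x ^ κ) (Ioi 0) ν := by
  set G : ℝ → ℝ := fun x => ν.real (Ici x) with hG
  set K : ℝ → ℝ := fun x => x ^ (-β) * L x with hK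
  have hKpos : ∀ᶠ x in atTop, 0 < K x := by
    filter_upwards [hA.slowlyVarying.eventually_pos, eventually_gt_atTop 0] with x hx hx0
    positivity
  have hGK : Tendsto (fun x => G x / K x) atTop (𝓝 1) :=
    (Asymptotics.isEquivalent_iff_tendsto_one (hKpos.mono fun x hx => hx.ne')).1 hA.tail
  have h2x : Tendsto (fun x : ℝ => 2 * x) atTop atTop := tendsto_id.const_mul_atTop two_pos
  have hratio : Tendsto (fun x => G (2 * x) / G x) atTop (𝓝 (2 ^ (-β))) := by
    have h1 := ((hGK.comp h2x).mul ((hA.slowlyVarying.tendsto_ratio 2 two_pos).const_mul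
      ((2 : ℝ) ^ (-β)))).div hGK one_ne_zero
    simp only [one_mul, mul_one, div_one] at h1
    refine h1.congr' ?_
    filter_upwards [hKpos, h2x.eventually hKpos, hGK.eventually_ne one_ne_zero,
      hA.slowlyVarying.eventually_pos, eventually_gt_atTop 0] with x hx1 hx2 hx3 hx4 hx5
    have hG0 : G x ≠ 0 := fun h => hx3 (by rw [h, zero_div])
    have e : K (2 * x) / K x = (2 : ℝ) ^ (-β) * (L (2 * x) / L x) := by
      simp only [hK]
      rw [Real.mul_rpow two_pos.le hx5.le]
      have : x ^ (-β) ≠ 0 := (Real.rpow_pos_of_pos hx5 _).ne'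
      field_simp
    simp only [Pi.div_apply, Function.comp_apply]
    rw [← e]
    have := hx1.ne'
    have := hx2.ne'
    field_simp
  -- A spare exponent absorbs the slowly varying factor: far out, doubling `x` shrinks the tail by
  -- at least `2 ^ (-β')`, and `κ < β'` makes the dyadic sum converge.
  obtain ⟨β', hβ1, hβ2⟩ := exists_between hκβ
  have hlt : (2 : ℝ) ^ (-β) < 2 ^ (-β') :=
    Real.rpow_lt_rpow_of_exponent_lt one_lt_two (by linarith)
  obtain ⟨x₀, hx₀⟩ := eventually_atTop.1 (hratio.eventually (gt_mem_nhds hlt))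
  set x₁ := max x₀ 1 with hx₁
  have hx₁1 : 1 ≤ x₁ := le_max_right _ _
  have hgeo : ∀ j : ℕ, G (2 ^ j * x₁) ≤ ((2 : ℝ) ^ (-β')) ^ j := by
    intro j
    induction j with
    | zero => simp [hG, measureReal_le_one]
    | succ j ih =>
      have hxj : x₀ ≤ 2 ^ j * x₁ :=
        (le_max_left _ _).trans (le_mul_of_one_le_left (by linarith) (one_le_pow₀ one_le_two))
      have h1 := hx₀ _ hxj
      have h2 : G (2 * (2 ^ j * x₁)) ≤ 2 ^ (-β') * G (2 ^ j * x₁) := by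
        rcases (measureReal_nonneg (μ := ν) (s := Ici (2 ^ j * x₁))).eq_or_lt with h0 | h0
        · have : G (2 * (2 ^ j * x₁)) ≤ G (2 ^ j * x₁) := by
            refine measureReal_mono (Ici_subset_Ici.2 ?_)
            have : (0 : ℝ) ≤ 2 ^ j * x₁ := by positivity
            linarith
          have h0' : G (2 ^ j * x₁) = 0 := h0.symm
          rw [h0'] at this ⊢
          simpa using this
        · exact ((div_lt_iff₀ h0).1 h1).le
      have e : (2 : ℝ) ^ (j + 1) * x₁ = 2 * (2 ^ j * x₁) := by ring
      rw [e, pow_succ']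
      exact h2.trans (mul_le_mul_of_nonneg_left ih (by positivity))
  have hmajor : ∀ x : ℝ, ENNReal.ofReal (x ^ κ) * (Ioi (0 : ℝ)).indicator 1 x ≤
      ENNReal.ofReal (x₁ ^ κ) + ∑' j : ℕ, ENNReal.ofReal ((2 ^ (j + 1) * x₁) ^ κ) *
        (Ici (2 ^ j * x₁)).indicator 1 x := by
    intro x
    rcases le_or_gt x 0 with hx | hx
    · simp [hx]
    rw [indicator_of_mem (mem_Ioi.2 hx), Pi.one_apply, mul_one]
    rcases le_total x x₁ with h | h
    · exact le_add_right (ENNReal.ofReal_le_ofReal (Real.rpow_le_rpow hx.le h hκ.le))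
    · obtain ⟨j, hj1, hj2⟩ := exists_nat_pow_near (x := x / x₁) (y := 2)
        ((one_le_div (by linarith)).2 h) one_lt_two
      rw [le_div_iff₀ (by linarith)] at hj1
      rw [div_lt_iff₀ (by linarith)] at hj2
      refine le_add_left (le_trans ?_ (ENNReal.le_tsum j))
      rw [indicator_of_mem (mem_Ici.2 hj1), Pi.one_apply, mul_one]
      exact ENNReal.ofReal_le_ofReal (Real.rpow_le_rpow hx.le hj2.le hκ.le)
  refine ⟨by fun_prop, ?_⟩
  rw [hasFiniteIntegral_iff_ofReal ((ae_restrict_iff' measurableSet_Ioi).2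
    (ae_of_all _ fun x hx => Real.rpow_nonneg (le_of_lt hx) _))]
  have hterm : ∀ j : ℕ, ENNReal.ofReal ((2 ^ (j + 1) * x₁) ^ κ) * ν (Ici (2 ^ j * x₁)) ≤
      ENNReal.ofReal ((2 * x₁) ^ κ * ((2 : ℝ) ^ (κ - β')) ^ j) := by
    intro j
    rw [← ofReal_measureReal, ← ENNReal.ofReal_mul (by positivity)]
    refine ENNReal.ofReal_le_ofReal ?_
    calc (2 ^ (j + 1) * x₁) ^ κ * ν.real (Ici (2 ^ j * x₁))
        ≤ (2 ^ (j + 1) * x₁) ^ κ * ((2 : ℝ) ^ (-β')) ^ j :=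
          mul_le_mul_of_nonneg_left (hgeo j) (by positivity)
      _ = _ := by
        have e1 : (2 : ℝ) ^ (j + 1) * x₁ = 2 ^ j * (2 * x₁) := by ring
        have e2 : ((2 : ℝ) ^ j) ^ κ = ((2 : ℝ) ^ κ) ^ j := by
          rw [← Real.rpow_natCast, ← Real.rpow_mul two_pos.le, mul_comm, Real.rpow_mul two_pos.le,
            Real.rpow_natCast]
        rw [e1, Real.mul_rpow (by positivity) (by positivity), e2, sub_eq_add_neg,
          Real.rpow_add two_pos, mul_pow]
        ring
  have hgsum : Summable fun j : ℕ => (2 * x₁) ^ κ * ((2 : ℝ) ^ (κ - β')) ^ j :=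
    (summable_geometric_of_lt_one (by positivity)
      (Real.rpow_lt_one_of_one_lt_of_neg one_lt_two (by linarith))).mul_left _
  calc ∫⁻ x in Ioi 0, ENNReal.ofReal (x ^ κ) ∂ν
      = ∫⁻ x, ENNReal.ofReal (x ^ κ) * (Ioi (0 : ℝ)).indicator 1 x ∂ν := by
        rw [← lintegral_indicator measurableSet_Ioi]
        refine lintegral_congr fun x => ?_
        by_cases hx : x ∈ Ioi (0 : ℝ) <;> simp [hx, indicator]
    _ ≤ ∫⁻ x, (ENNReal.ofReal (x₁ ^ κ) + ∑' j : ℕ, ENNReal.ofReal ((2 ^ (j + 1) * x₁) ^ κ) *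
        (Ici (2 ^ j * x₁)).indicator 1 x) ∂ν := lintegral_mono hmajor
    _ = ENNReal.ofReal (x₁ ^ κ) + ∑' j : ℕ, ENNReal.ofReal ((2 ^ (j + 1) * x₁) ^ κ) *
        ν (Ici (2 ^ j * x₁)) := by
        have hm : ∀ j : ℕ, Measurable ((Ici ((2 : ℝ) ^ j * x₁)).indicator
            (1 : ℝ → ENNReal)) := fun j => measurable_one.indicator measurableSet_Ici
        rw [lintegral_add_left measurable_const,
          lintegral_tsum fun j => ((hm j).const_mul _).aemeasurable]
        simp only [lintegral_const, measure_univ, mul_one]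
        congr 1
        refine tsum_congr fun j => ?_
        rw [lintegral_const_mul _ (hm j), lintegral_indicator_one measurableSet_Ici]
    _ < ⊤ := by
        refine ENNReal.add_lt_top.2 ⟨ENNReal.ofReal_lt_top, ?_⟩
        refine lt_of_le_of_lt (ENNReal.tsum_le_tsum hterm) ?_
        rw [← ENNReal.ofReal_tsum_of_nonneg (fun j => by positivity) hgsum]
        exact ENNReal.ofReal_lt_top

end StepLaw

/-! ### Summability against `q` and decomposition over the values of `Z_n`. -/

section Schroeder

/-- Fubini: the sum is the expectation of `∑ q k * k` over `k < X / c`, which is at most `C (X /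
c)^γ (X / c)`. -/
theorem summable_mul_tail {ν : Measure ℝ} [IsProbabilityMeasure ν] {q : ℕ → ℝ} {C γ c : ℝ}
    (hq0 : ∀ k, 0 ≤ q k)
    (hq : ∀ N : ℕ, 1 ≤ N → ∑ k ∈ Finset.range (N + 1), q k ≤ C * (N : ℝ) ^ γ)
    (hC : 0 < C) (hγ : 0 < γ) (hc : 0 < c)
    (hν : IntegrableOn (fun x : ℝ => x ^ (1 + γ)) (Ioi 0) ν) :
    Summable fun k : ℕ => q k * (k * ν.real (Ioi (c * k))) := by
  have hpt : ∀ (n : ℕ) (x : ℝ),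
      ∑ k ∈ Finset.range n, q k * (k * (Ioi (c * k)).indicator (1 : ℝ → ℝ) x) ≤
        (Ioi (0 : ℝ)).indicator (fun x : ℝ => C * (c ^ (1 + γ))⁻¹ * x ^ (1 + γ)) x := by
    intro n x
    rcases le_or_gt x 0 with hx | hx
    · rw [indicator_of_notMem (by simpa using hx)]
      refine Finset.sum_nonpos fun k _ => ?_
      have : (0 : ℝ) ≤ c * k := by positivity
      rw [indicator_of_notMem (by simpa using hx.trans this)]
      simp
    rw [indicator_of_mem (mem_Ioi.2 hx)]
    set y := x / c with hy
    have hy0 : 0 < y := by positivity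
    have hmem : ∀ k : ℕ, x ∈ Ioi (c * k) → (k : ℝ) < y := fun k hk => by
      rw [hy, lt_div_iff₀ hc, mul_comm]; exact hk
    -- The bound on partial sums of `q` starts at `N = 1`. When the floor is 0, only `k = 0` could
    -- contribute, and its factor `k` kills it.
    rcases Nat.eq_zero_or_pos ⌊y⌋₊ with h0 | h0
    · have hy1 : y < 1 := Nat.floor_eq_zero.1 h0
      refine (Finset.sum_nonpos fun k _ => ?_).trans (by positivity)
      rcases Nat.eq_zero_or_pos k with rfl | hk
      · simp
      · rw [indicator_of_notMem fun hxk => ?_]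
        · simp
        · have := hmem k hxk
          have : (1 : ℝ) ≤ k := by exact_mod_cast hk
          linarith
    · calc ∑ k ∈ Finset.range n, q k * (k * (Ioi (c * k)).indicator (1 : ℝ → ℝ) x)
          ≤ ∑ k ∈ Finset.range n, if k ∈ Finset.range (⌊y⌋₊ + 1) then q k * y else 0 := by
            refine Finset.sum_le_sum fun k _ => ?_
            by_cases hk : x ∈ Ioi (c * k)
            · have h1 := hmem k hk
              have h2 : k ∈ Finset.range (⌊y⌋₊ + 1) :=
                Finset.mem_range.2 (Nat.lt_succ_of_le (Nat.le_floor h1.le))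
              rw [indicator_of_mem hk, if_pos h2, Pi.one_apply, mul_one]
              exact mul_le_mul_of_nonneg_left h1.le (hq0 k)
            · rw [indicator_of_notMem hk, mul_zero, mul_zero]
              split_ifs
              · exact mul_nonneg (hq0 k) hy0.le
              · exact le_rfl
        _ ≤ ∑ k ∈ Finset.range (⌊y⌋₊ + 1), q k * y := by
            rw [← Finset.sum_filter]
            refine Finset.sum_le_sum_of_subset_of_nonneg (fun k hk => (Finset.mem_filter.1 hk).2)
              fun k _ _ => mul_nonneg (hq0 k) hy0.le
        _ = (∑ k ∈ Finset.range (⌊y⌋₊ + 1), q k) * y := (Finset.sum_mul _ _ _).symm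
        _ ≤ C * y ^ γ * y := by
            refine mul_le_mul_of_nonneg_right ((hq _ h0).trans ?_) hy0.le
            gcongr
            exact Nat.floor_le hy0.le
        _ = C * (c ^ (1 + γ))⁻¹ * x ^ (1 + γ) := by
            rw [mul_assoc, ← Real.rpow_add_one hy0.ne', add_comm γ 1, hy,
              Real.div_rpow hx.le hc.le]
            ring
  have hI : ∀ k : ℕ, Integrable
      (fun x => q k * (k * (Ioi (c * k)).indicator (1 : ℝ → ℝ) x)) ν := fun k =>
    (((integrable_const (1 : ℝ)).indicator measurableSet_Ioi).const_mul _).const_mul _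
  have hR : Integrable ((Ioi (0 : ℝ)).indicator
      (fun x : ℝ => C * (c ^ (1 + γ))⁻¹ * x ^ (1 + γ))) ν :=
    (integrable_indicator_iff measurableSet_Ioi).2 (hν.const_mul _)
  refine summable_of_sum_range_le (fun k => mul_nonneg (hq0 k) (by positivity)) (c := ∫ x,
    (Ioi (0 : ℝ)).indicator (fun x : ℝ => C * (c ^ (1 + γ))⁻¹ * x ^ (1 + γ)) x ∂ν) fun n => ?_
  calc ∑ k ∈ Finset.range n, q k * (k * ν.real (Ioi (c * k)))
      = ∑ k ∈ Finset.range n,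
          ∫ x, q k * (k * (Ioi (c * k)).indicator (1 : ℝ → ℝ) x) ∂ν := by
        refine Finset.sum_congr rfl fun k _ => ?_
        rw [integral_const_mul, integral_const_mul, integral_indicator_one measurableSet_Ioi]
    _ = ∫ x, ∑ k ∈ Finset.range n, q k * (k * (Ioi (c * k)).indicator (1 : ℝ → ℝ) x) ∂ν :=
        (integral_finsetSum _ fun k _ => hI k).symm
    _ ≤ _ := integral_mono (integrable_finsetSum _ fun k _ => hI k) hR (hpt n)

/-- A single `q k` is at most `C k ^ γ`, so the exponent `γ + 2` leaves `k ^ (-2)`. -/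
theorem summable_mul_rpow_neg {q : ℕ → ℝ} {C γ : ℝ} (hq0 : ∀ k, 0 ≤ q k)
    (hq : ∀ N : ℕ, 1 ≤ N → ∑ k ∈ Finset.range (N + 1), q k ≤ C * (N : ℝ) ^ γ) :
    Summable fun k : ℕ => q k * (k : ℝ) ^ (-(γ + 2)) := by
  refine Summable.of_norm_bounded_eventually_nat (g := fun k : ℕ => C * (k : ℝ) ^ (-2 : ℝ))
    ((Real.summable_nat_rpow.2 (by norm_num)).mul_left C) ?_
  filter_upwards [eventually_ge_atTop 1] with k hk
  have hk0 : (0 : ℝ) < k := by exact_mod_cast hk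
  rw [Real.norm_eq_abs, abs_of_nonneg (mul_nonneg (hq0 k) (by positivity))]
  have h1 : q k ≤ C * (k : ℝ) ^ γ :=
    (Finset.single_le_sum (fun j _ => hq0 j) (Finset.self_mem_range_succ k)).trans (hq k hk)
  calc q k * (k : ℝ) ^ (-(γ + 2)) ≤ C * (k : ℝ) ^ γ * (k : ℝ) ^ (-(γ + 2)) := by gcongr
    _ = C * (k : ℝ) ^ (-2 : ℝ) := by
        rw [mul_assoc, ← Real.rpow_add hk0]
        ring_nf

/-- Writes `Z_n` as a fixed function of the whole offspring array, so that independence of the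
arrays passes to `Z_n` and `S_k`. -/
theorem galtonWatson_eq_comp {Ω : Type*} (ξ : ℕ → ℕ → Ω → ℕ) (n : ℕ) (ω : Ω) :
    galtonWatson ξ n ω =
      galtonWatson (fun l i (x : ℕ × ℕ → ℕ) => x (l, i)) n (fun j => ξ j.1 j.2 ω) := by
  induction n with
  | zero => rfl
  | succ n ih => simp only [galtonWatson, ← ih]

/-- The law of the ratio `S_Z / Z`, decomposed according to the value of `Z`. -/
theorem hasSum_measureReal_ratio {Ω : Type*} [MeasurableSpace Ω] {μ : Measure Ω}
    [IsProbabilityMeasure μ] {ξ : ℕ → ℕ → Ω → ℕ} (hξm : ∀ n i, Measurable (ξ n i))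
    {X : ℕ → Ω → ℝ} (hXm : ∀ i, Measurable (X i))
    (hξX : IndepFun (fun ω (j : ℕ × ℕ) => ξ j.1 j.2 ω) (fun ω (i : ℕ) => X i ω) μ)
    {ε : ℝ} (hε : 0 < ε) (n : ℕ) :
    HasSum (fun k : ℕ => μ.real {ω | galtonWatson ξ n ω = k + 1} *
        μ.real {ω | ε * ((k + 1 : ℕ) : ℝ) ≤ partialSum X (k + 1) ω})
      (μ.real {ω | ε ≤ partialSum X (galtonWatson ξ n ω) ω / (galtonWatson ξ n ω : ℝ)}) := by
  have hZ := measurable_galtonWatson_of n fun l _ i => hξm l i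
  have hS : ∀ k, Measurable (partialSum X k) := fun k =>
    Finset.measurable_fun_sum _ fun i _ => hXm i
  have hind : ∀ k, IndepFun (galtonWatson ξ n) (partialSum X k) μ := by
    intro k
    have h1 := hξX.comp (φ := galtonWatson (fun l i (x : ℕ × ℕ → ℕ) => x (l, i)) n)
      (ψ := fun x : ℕ → ℝ => ∑ i ∈ Finset.range k, x i)
      (measurable_galtonWatson_of n fun l _ i => measurable_pi_apply _) (by fun_prop)
    refine h1.congr (ae_of_all _ fun ω => ?_) (ae_of_all _ fun ω => rfl)
    exact (galtonWatson_eq_comp ξ n ω).symm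
  have hset : {ω | ε ≤ partialSum X (galtonWatson ξ n ω) ω / (galtonWatson ξ n ω : ℝ)} =
      ⋃ k : ℕ, galtonWatson ξ n ⁻¹' {k + 1} ∩
        partialSum X (k + 1) ⁻¹' Ici (ε * ((k + 1 : ℕ) : ℝ)) := by
    ext ω
    simp only [mem_ofPred_eq, mem_iUnion, mem_inter_iff, mem_preimage, mem_singleton_iff, mem_Ici]
    rcases Nat.eq_zero_or_pos (galtonWatson ξ n ω) with h0 | h0
    -- On `Z_n = 0` the ratio is `0 / 0 = 0 < ε`, so the values `k + 1` suffice.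
    · simp [h0, hε.not_ge]
    · obtain ⟨k, hk⟩ : ∃ k, galtonWatson ξ n ω = k + 1 := ⟨_, (Nat.sub_add_cancel h0).symm⟩
      have hk0 : (0 : ℝ) < ((k + 1 : ℕ) : ℝ) := by positivity
      rw [hk, le_div_iff₀ hk0]
      constructor
      · exact fun h => ⟨k, rfl, h⟩
      · rintro ⟨l, hl, h⟩
        obtain rfl : k = l := by omega
        exact h
  have hmeas : ∀ k : ℕ, MeasurableSet (galtonWatson ξ n ⁻¹' {k + 1} ∩
      partialSum X (k + 1) ⁻¹' Ici (ε * ((k + 1 : ℕ) : ℝ))) := fun k =>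
    (hZ (measurableSet_singleton _)).inter (hS _ measurableSet_Ici)
  have hdisj : Pairwise (Function.onFun Disjoint fun k : ℕ => galtonWatson ξ n ⁻¹' {k + 1} ∩
      partialSum X (k + 1) ⁻¹' Ici (ε * ((k + 1 : ℕ) : ℝ))) := by
    intro a b hab
    refine Set.disjoint_left.2 fun ω h1 h2 => hab ?_
    have h3 : a + 1 = b + 1 := h1.1.symm.trans h2.1
    omega
  have hms := measure_iUnion hdisj hmeas (μ := μ)
  have hfin : ∑' k : ℕ, μ (galtonWatson ξ n ⁻¹' {k + 1} ∩
      partialSum X (k + 1) ⁻¹' Ici (ε * ((k + 1 : ℕ) : ℝ))) ≠ ⊤ := hms ▸ measure_ne_top _ _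
  rw [hset, measureReal_def, hms]
  have h1 := ENNReal.hasSum_toReal hfin
  rw [← ENNReal.tsum_toReal_eq fun k => measure_ne_top _ _] at h1
  convert h1 using 2 with k
  rw [(hind (k + 1)).measure_inter_preimage_eq_mul _ _ (measurableSet_singleton _)
    measurableSet_Ici, ENNReal.toReal_mul]
  rfl

end Schroeder

/-! ### Conclusion by dominated convergence. -/

theorem mainTheorem5
    {Ω : Type*} [MeasurableSpace Ω] (μ : Measure Ω) [IsProbabilityMeasure μ]
    -- the offspring law and the independent offspring variables
    (p : PMF ℕ) (hp : OffspringAssumption p)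
    (ξ : ℕ → ℕ → Ω → ℕ) (hξm : ∀ n i, Measurable (ξ n i))
    (hξlaw : ∀ n i, HasLaw (ξ n i) p.toMeasure μ)
    (hξ : iIndepFun (fun j : ℕ × ℕ => ξ j.1 j.2) μ)
    -- the i.i.d. summands, independent of the Galton-Watson process
    (ν : Measure ℝ) (X : ℕ → Ω → ℝ) (hXm : ∀ i, Measurable (X i))
    (hXlaw : ∀ i, HasLaw (X i) ν μ)
    (hX : iIndepFun X μ)
    (hξX : IndepFun (fun ω (j : ℕ × ℕ) => ξ j.1 j.2 ω) (fun ω (i : ℕ) => X i ω) μ)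
    -- `X_1` is attracted, with norming function `b`, to the strictly `α`-stable law `ρ`
    (α β : ℝ) (hα0 : 0 < α) (hα2 : α < 2) (hβ : 0 < β)
    (L : ℝ → ℝ) (hA : StepTailAssumption ν α β L)
    (b : ℝ → ℝ) (hb : IsNormingFunction b)
    (ρ : Measure ℝ) [IsProbabilityMeasure ρ] (hρ : IsStrictlyStable α ρ)
    (hattr : TendstoInDistribution (fun (k : ℕ) ω => partialSum X k ω / b k) atTop
      (id : ℝ → ℝ) (fun _ => μ) ρ)
    (hB : StepTechnicalAssumption ν α β b)
    -- the Schröder constant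
    (γ : ℝ) (hγ : offspringMean p ^ (-γ) = (p 1).toReal)
    (hcase : (1 < α ∧ α < 2 ∧ γ < β - 1) ∨
      IntegrableOn (fun x : ℝ => x ^ (1 + γ)) (Ioi 0) ν) :
    ∃ q : ℕ → ℝ,
      (∀ k : ℕ, 1 ≤ k →
        Tendsto (fun n : ℕ => offspringMean p ^ (γ * n) * μ.real {ω | galtonWatson ξ n ω = k})
          atTop (𝓝 (q k))) ∧
      ∀ ε : ℝ, 0 < ε →
        Summable (fun k : ℕ =>
          q (k + 1) * μ.real {ω | ε * ((k + 1 : ℕ) : ℝ) ≤ partialSum X (k + 1) ω}) ∧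
        Tendsto (fun n : ℕ => offspringMean p ^ (γ * n) *
            μ.real {ω | ε ≤ partialSum X (galtonWatson ξ n ω) ω / (galtonWatson ξ n ω : ℝ)})
          atTop
          (𝓝 (∑' k : ℕ,
            q (k + 1) * μ.real {ω | ε * ((k + 1 : ℕ) : ℝ) ≤ partialSum X (k + 1) ω})) := by
  have : IsProbabilityMeasure ν := (hXlaw 0).isProbabilityMeasure_iff.1 inferInstance
  have hγ0 := hp.schroeder_pos hγ
  obtain ⟨q, C, hC, hqle, hqlim, hqsum⟩ := exists_schroeder_limit hp hξm hξlaw hξ hγ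
  have hm0 : 0 < offspringMean p := by linarith [hp.one_lt_mean]
  have ha0 : ∀ (n : ℕ) k,
      0 ≤ offspringMean p ^ (γ * n) * μ.real {ω | galtonWatson ξ n ω = k} :=
    fun n k => by positivity
  have hq0 : ∀ k, 0 ≤ q k := fun k => (ha0 0 k).trans (hqle 0 k)
  -- Both alternatives reduce to a finite moment of order `1 + γ` of the positive part.
  have hmom : IntegrableOn (fun x : ℝ => x ^ (1 + γ)) (Ioi 0) ν := by
    rcases hcase with ⟨-, -, h⟩ | h
    · exact integrableOn_rpow_of_tail hA (by linarith) (by linarith)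
    · exact h
  have hmax : ∀ M : ℝ, 0 ≤ M → Integrable (fun x => max x (-M)) ν := fun M hM => by
    have h1 := integrable_abs_max_rpow hmom zero_le_one (by linarith) hM
    simp only [Real.rpow_one] at h1
    exact h1.mono' (by fun_prop) (ae_of_all _ fun x => le_rfl)
  refine ⟨q, fun k _ => hqlim k, fun ε hε => ?_⟩
  obtain ⟨M, hM, hMle⟩ := exists_integral_max_le (ν := ν) (by simpa using hmax 0 le_rfl)
    (fun hint => (mean_eq_zero_of_attracted hXm hXlaw hX hint hb.pos hρ.nondegenerate hattr).le)
    (half_pos hε)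
  -- The order `r` is capped by the available moment `1 + γ` and by 2; `κ = γ + 2` beats the growth
  -- of `q`.
  obtain ⟨c, hc, hdev⟩ := exists_partialSum_tail_le hXm hXlaw hX (M := M) (r := min (1 + γ) 2)
    (ε := ε) (κ := γ + 2) (lt_min (by linarith) one_lt_two) (min_le_right _ _)
    (integrable_abs_max_rpow hmom (by positivity) (min_le_left _ _) hM.le) (hmax M hM.le) hε
    (by positivity) hMle
  have hsum : Summable fun k : ℕ => q k * μ.real {ω | ε * (k : ℝ) ≤ partialSum X k ω} := by
    refine Summable.of_norm_bounded_eventually_nat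
      ((summable_mul_tail hq0 hqsum hC hγ0 hc hmom).add (summable_mul_rpow_neg hq0 hqsum)) ?_
    filter_upwards [hdev] with k hk
    rw [Real.norm_eq_abs, abs_of_nonneg (mul_nonneg (hq0 k) measureReal_nonneg), ← mul_add]
    exact mul_le_mul_of_nonneg_left hk (hq0 k)
  have hsum1 := (summable_nat_add_iff 1).2 hsum
  refine ⟨hsum1, ?_⟩
  -- The weights approach `q` from below, so the limiting series is itself the dominating one.
  have hdom := tendsto_tsum_of_dominated_convergence (𝓕 := atTop)
    (f := fun (n k : ℕ) => offspringMean p ^ (γ * n) * μ.real {ω | galtonWatson ξ n ω = k + 1} *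
      μ.real {ω | ε * ((k + 1 : ℕ) : ℝ) ≤ partialSum X (k + 1) ω}) hsum1
    (fun k => (hqlim (k + 1)).mul_const _)
    (Eventually.of_forall fun n k => by
      rw [Real.norm_eq_abs, abs_of_nonneg (mul_nonneg (ha0 n _) measureReal_nonneg)]
      exact mul_le_mul_of_nonneg_right (hqle n (k + 1)) measureReal_nonneg)
  refine hdom.congr fun n => ?_
  rw [← (hasSum_measureReal_ratio hξm hXm hξX hε n).tsum_eq, ← tsum_mul_left]
  exact tsum_congr fun k => mul_assoc _ _ _
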